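/- Let $\mathcal{D}(\mathbb{R})$ be the space of smooth compactly supported functions on $\mathbb{R}$. For continuous $f:\mathbb{R}\to\mathbb{R}$ put $${\rm TV}^{(2)}(f)=\sup\Big\{\int_{\mathbb{R}} f(x)\varphi''(x)\,{\rm d}x:\ \varphi\in\mathcal{D}(\mathbb{R}),\ \|\varphi\|_{\infty}=1\Big\}\in[0,\infty],\qquad L(f)=\sup_{x_1\ne x_2}\frac{|f(x_1)-f(x_2)|}{|x_1-x_2|}\in[0,\infty],$$ and let ${\rm BV}^{(2)}(\mathbb{R})=\{f:\mathbb{R}\to\mathbb{R}\text{ continuous}:\ {\rm TV}^{(2)}(f)<\infty\}$. For $f\in{\rm BV}^{(2)}(\mathbb{R})$ the weak second derivative ${\rm D}^2f$ is a bounded Radon measure, i.e. an element of $\mathcal{M}(\mathbb{R})=C_0(\mathbb{R})'$. The map $f\mapsto({\rm D}^2f,f(0),f(1))$ identifies ${\rm BV}^{(2)}(\mathbb{R})$ with $\mathcal{M}(\mathbb{R})\times\mathbb{R}^2=(C_0(\mathbb{R})\times\mathbb{R}^2)'$; the weak*-topology on ${\rm BV}^{(2)}(\mathbb{R})$ is the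 one transported by this identification. Let $M\ge 2$, let $x_1<x_2<\cdots<x_M$ and $y_1,\dots,y_M$ be real numbers, let $\lambda>0$ and $\bar L>0$, and let $E:\mathbb{R}\times\mathbb{R}\to\mathbb{R}$ be such that, for every $y\in\mathbb{R}$, the function $E(\cdot,y)$ is strictly convex and coercive (i.e. $E(u,y)\to+\infty$ as $|u|\to\infty$). Let $$\mathcal{V}_{\rm hyb}=\operatorname*{arg\,min}_{f\in{\rm BV}^{(2)}(\mathbb{R})}\Big(\sum_{m=1}^M E(f(x_m),y_m)+\lambda\,{\rm TV}^{(2)}(f)\Big)\quad\text{subject to}\quad L(f)\le\bar L .$$ Then $\mathcal{V}_{\rm hyb}$ is a nonempty, convex and weak*-compact subset of ${\rm BV}^{(2)}(\mathbb{R})$, and each of its extreme points is a linear spline (a continuous piecewise-linear function) with at most $M-1$ linear regions. Moreover, there exists a unique vector ${\bf z}=(z_m)\in\mathbb{R}^M$ such that $$\mathcal{V}_{\rm hyb}=\operatorname*{arg\,min}_{f\in{\rm BV}^{(2)}(\mathbb{R})}{\rm TV}^{(2)}(f)\quad\text{subject to}\quad f(x_m)=z_m,\ 1\le m\le M .$$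 Finally, the optimal ${\rm TV}^{(2)}$ cost, i.e. the common value of ${\rm TV}^{(2)}(f)$ for $f\in\mathcal{V}_{\rm hyb}$, is $${\rm TV}_{\min}=\sum_{m=2}^{M-1}\left|\frac{z_m-z_{m-1}}{x_m-x_{m-1}}-\frac{z_m-z_{m+1}}{x_m-x_{m+1}}\right| .$$ -/

import Mathlib

open scoped ENNReal ZeroAtInfty Topology

theorem two_le_infty : (2 : WithTop ℕ∞) ≤ ((⊤ : ℕ∞) : WithTop ℕ∞) :=
  WithTop.coe_le_coe.2 (le_top : (2 : ℕ∞) ≤ ⊤)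

/-- The space `𝒟(ℝ)` of real-valued, smooth, compactly supported test functions on the line. -/
abbrev TestFn : Type := TestFunction (⊤ : TopologicalSpace.Opens ℝ) ℝ ⊤

theorem TestFn.contDiff' (φ : TestFn) : ContDiff ℝ (⊤ : ℕ∞) (φ : ℝ → ℝ) := φ.contDiff

theorem TestFn.hasCompactSupport' (φ : TestFn) : HasCompactSupport (φ : ℝ → ℝ) :=
  φ.hasCompactSupport

/-- The inclusion of `𝒟(ℝ)` in the Banach space `C₀(ℝ)` (sup norm). -/
noncomputable def TestFn.toC0 : TestFn →ₗ[ℝ] C₀(ℝ, ℝ) where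
  toFun φ :=
    { toFun := φ
      continuous_toFun := φ.contDiff'.continuous
      zero_at_infty' := φ.hasCompactSupport'.is_zero_at_infty }
  map_add' _ _ := rfl
  map_smul' _ _ := rfl

@[simp] theorem TestFn.toC0_apply (φ : TestFn) (x : ℝ) : TestFn.toC0 φ x = φ x := rfl

/-- The action `⟨D² f, φ⟩ = ⟨f, φ''⟩ = ∫ f φ''` of the distributional second derivative of `f`. -/
noncomputable def d2Pairing (f : ℝ → ℝ) (φ : TestFn) : ℝ :=
  ∫ x, f x * iteratedDeriv 2 φ x

/-- The second-order total variation
`TV⁽²⁾(f) = sup { ∫ f φ'' : φ ∈ 𝒟(ℝ), ‖φ‖_∞ = 1 } ∈ [0, ∞]`. -/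
noncomputable def TV2 (f : ℝ → ℝ) : ℝ≥0∞ :=
  ⨆ (φ : TestFn) (_ : ‖TestFn.toC0 φ‖ = 1), ENNReal.ofReal (d2Pairing f φ)

theorem TestFn.continuous_d2 (φ : TestFn) : Continuous (iteratedDeriv 2 (φ : ℝ → ℝ)) :=
  φ.contDiff'.continuous_iteratedDeriv 2 two_le_infty

theorem TestFn.hasCompactSupport_d2 (φ : TestFn) :
    HasCompactSupport (iteratedDeriv 2 (φ : ℝ → ℝ)) := by
  rw [iteratedDeriv_succ, iteratedDeriv_one]
  exact φ.hasCompactSupport'.deriv.deriv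

theorem integrable_mul_d2 {f : ℝ → ℝ} (hf : Continuous f) (φ : TestFn) :
    MeasureTheory.Integrable (fun x => f x * iteratedDeriv 2 φ x) :=
  (hf.mul φ.continuous_d2).integrable_of_hasCompactSupport φ.hasCompactSupport_d2.mul_left

theorem d2Pairing_add_left {f g : ℝ → ℝ} (hf : Continuous f) (hg : Continuous g) (φ : TestFn) :
    d2Pairing (f + g) φ = d2Pairing f φ + d2Pairing g φ := by
  simp only [d2Pairing, Pi.add_apply, add_mul]
  exact MeasureTheory.integral_add (integrable_mul_d2 hf φ) (integrable_mul_d2 hg φ)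

theorem d2Pairing_smul_left (c : ℝ) (f : ℝ → ℝ) (φ : TestFn) :
    d2Pairing (c • f) φ = c * d2Pairing f φ := by
  simp only [d2Pairing, Pi.smul_apply, smul_eq_mul, mul_assoc]
  exact MeasureTheory.integral_const_mul _ _

theorem d2Pairing_add_right {f : ℝ → ℝ} (hf : Continuous f) (φ ψ : TestFn) :
    d2Pairing f (φ + ψ) = d2Pairing f φ + d2Pairing f ψ := by
  have h : ∀ x, iteratedDeriv 2 (φ + ψ : TestFn) x
      = iteratedDeriv 2 φ x + iteratedDeriv 2 ψ x := fun x =>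
    iteratedDeriv_add (f := (φ : ℝ → ℝ)) (g := (ψ : ℝ → ℝ))
      (φ.contDiff'.contDiffAt.of_le two_le_infty)
      (ψ.contDiff'.contDiffAt.of_le two_le_infty)
  simp only [d2Pairing, h, mul_add]
  exact MeasureTheory.integral_add (integrable_mul_d2 hf φ) (integrable_mul_d2 hf ψ)

theorem d2Pairing_smul_right (f : ℝ → ℝ) (c : ℝ) (φ : TestFn) :
    d2Pairing f (c • φ) = c * d2Pairing f φ := by
  have h : ∀ x, iteratedDeriv 2 (c • φ : TestFn) x = c * iteratedDeriv 2 φ x := fun x =>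
    iteratedDeriv_const_mul_field (n := 2) (x := x) c (φ : ℝ → ℝ)
  simp only [d2Pairing, h, mul_left_comm]
  exact MeasureTheory.integral_const_mul _ _

theorem TV2_add_le {f g : ℝ → ℝ} (hf : Continuous f) (hg : Continuous g) :
    TV2 (f + g) ≤ TV2 f + TV2 g := by
  refine iSup₂_le fun φ hφ => ?_
  rw [d2Pairing_add_left hf hg]
  exact ENNReal.ofReal_add_le.trans
    (add_le_add (le_iSup₂_of_le φ hφ le_rfl) (le_iSup₂_of_le φ hφ le_rfl))

theorem d2Pairing_le {f : ℝ → ℝ} (hT : TV2 f < ⊤) {φ : TestFn} (hφ : ‖TestFn.toC0 φ‖ = 1) :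
    d2Pairing f φ ≤ (TV2 f).toReal := by
  have h : ENNReal.ofReal (d2Pairing f φ) ≤ TV2 f := le_iSup₂_of_le φ hφ le_rfl
  exact (ENNReal.ofReal_le_iff_le_toReal hT.ne).1 h

theorem abs_d2Pairing_le {f : ℝ → ℝ} (hT : TV2 f < ⊤) (φ : TestFn) :
    |d2Pairing f φ| ≤ (TV2 f).toReal * ‖TestFn.toC0 φ‖ := by
  by_cases h0 : ‖TestFn.toC0 φ‖ = 0
  · have h1 : φ = 0 := by
      ext x
      have h2 := norm_eq_zero.1 h0
      simpa using DFunLike.congr_fun h2 x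
    subst h1
    have h3 := d2Pairing_smul_right f 0 0
    rw [zero_smul, zero_mul] at h3
    simp [h3]
  · have hpos : 0 < ‖TestFn.toC0 φ‖ := lt_of_le_of_ne (norm_nonneg _) (Ne.symm h0)
    have key : ∀ s : ℝ, |s| = 1 → s * d2Pairing f φ ≤ (TV2 f).toReal * ‖TestFn.toC0 φ‖ := by
      intro s hs
      have h4 : ‖TestFn.toC0 ((s * ‖TestFn.toC0 φ‖⁻¹) • φ)‖ = 1 := by
        rw [map_smul, norm_smul, Real.norm_eq_abs, abs_mul, hs, one_mul, abs_inv, abs_norm,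
          inv_mul_cancel₀ h0]
      have h5 := d2Pairing_le hT h4
      rw [d2Pairing_smul_right] at h5
      calc s * d2Pairing f φ
          = (s * ‖TestFn.toC0 φ‖⁻¹ * d2Pairing f φ) * ‖TestFn.toC0 φ‖ := by field_simp
        _ ≤ _ := mul_le_mul_of_nonneg_right h5 hpos.le
    rw [abs_le]
    constructor
    · have := key (-1) (by simp)
      linarith
    · have := key 1 (by simp)
      linarith

theorem TV2_smul_lt_top (c : ℝ) {f : ℝ → ℝ} (hT : TV2 f < ⊤) : TV2 (c • f) < ⊤ := by
  refine lt_of_le_of_lt (iSup₂_le fun φ hφ => ?_)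
    (ENNReal.ofReal_lt_top (r := |c| * (TV2 f).toReal))
  refine ENNReal.ofReal_le_ofReal ?_
  rw [d2Pairing_smul_left]
  refine (le_abs_self _).trans ?_
  rw [abs_mul]
  refine mul_le_mul_of_nonneg_left ?_ (abs_nonneg c)
  simpa [hφ] using abs_d2Pairing_le hT φ

/-- The space `BV⁽²⁾(ℝ)` of functions with finite second-order total variation. A distribution
whose second derivative is a bounded measure is a continuous function, and its elements are
identified with their continuous representatives, so that point values make sense. -/
noncomputable def BV2 : Submodule ℝ (ℝ → ℝ) where
  carrier := {f | Continuous f ∧ TV2 f < ⊤}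
  add_mem' := fun {_ _} hf hg => ⟨hf.1.add hg.1,
    lt_of_le_of_lt (TV2_add_le hf.1 hg.1) (ENNReal.add_lt_top.2 ⟨hf.2, hg.2⟩)⟩
  zero_mem' := by
    refine ⟨continuous_zero, ?_⟩
    have h : TV2 0 = 0 := by simp [TV2, d2Pairing]
    simp [h]
  smul_mem' := fun c _ hf => ⟨hf.1.const_smul c, TV2_smul_lt_top c hf.2⟩

/-- Test functions are dense in `C₀(ℝ)`. -/
theorem TestFn.denseRange_toC0 : DenseRange TestFn.toC0 := by
  intro g
  rw [Metric.mem_closure_iff]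
  intro ε hε
  obtain ⟨h, hh, hgh⟩ := Continuous.exists_contDiff_approx (E := ℝ) ⊤ (f := (g : ℝ → ℝ))
    (ε := fun _ => ε / 4) g.continuous continuous_const (fun _ => by positivity)
  have hlim : ∀ᶠ x in Filter.cocompact ℝ, |g x| < ε / 4 := by
    have := g.zero_at_infty'
    have h2 := (Metric.tendsto_nhds.1 this) (ε / 4) (by positivity)
    simpa [Real.dist_eq] using h2
  obtain ⟨K, hK, hKg⟩ := Filter.mem_cocompact.1 hlim
  obtain ⟨r, hr0, hr⟩ := (hK.isBounded.subset_closedBall_lt 0 (0 : ℝ))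
  let χ : ContDiffBump (0 : ℝ) := ⟨r, r + 1, hr0, by linarith⟩
  let φ : TestFn :=
    { toFun := fun x => χ x * h x
      contDiff' := χ.contDiff.mul hh
      hasCompactSupport' := χ.hasCompactSupport.mul_right
      tsupport_subset' := fun _ _ => trivial }
  refine ⟨TestFn.toC0 φ, ⟨φ, rfl⟩, ?_⟩
  refine lt_of_le_of_lt (b := ε / 2) ?_ (by linarith)
  rw [ZeroAtInftyContinuousMap.dist_toBCF_eq_dist.symm]
  refine (BoundedContinuousFunction.dist_le (by positivity)).2 fun x => ?_
  change dist (g x) (χ x * h x) ≤ ε / 2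
  rw [Real.dist_eq]
  have hχ0 : 0 ≤ χ x := χ.nonneg
  have hχ1 : χ x ≤ 1 := χ.le_one
  have h1 : |h x - g x| ≤ ε / 4 := by
    have := (hgh.1 x).le
    simpa [Real.dist_eq, abs_sub_comm] using this
  have h2 : |(1 - χ x) * g x| ≤ ε / 4 := by
    by_cases hx : x ∈ K
    · have h3 : χ x = 1 := χ.one_of_mem_closedBall (hr hx)
      simp only [h3, sub_self, zero_mul, abs_zero]
      positivity
    · have h4 : |g x| < ε / 4 := hKg hx
      rw [abs_mul, abs_of_nonneg (by linarith)]
      nlinarith [abs_nonneg (g x)]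
  have h5 : |χ x * (h x - g x)| ≤ ε / 4 := by
    rw [abs_mul, abs_of_nonneg hχ0]
    nlinarith [abs_nonneg (h x - g x)]
  calc |g x - χ x * h x| = |(1 - χ x) * g x - χ x * (h x - g x)| := by ring_nf
    _ ≤ |(1 - χ x) * g x| + |χ x * (h x - g x)| := abs_sub _ _
    _ ≤ ε / 2 := by linarith

/-- The distributional second derivative of `f ∈ BV⁽²⁾(ℝ)` extends uniquely to a bounded Radon
measure, that is, to an element of `𝓜(ℝ) = C₀(ℝ)'`. -/
theorem existsUnique_weakD2 (f : BV2) :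
    ∃! w : StrongDual ℝ C₀(ℝ, ℝ), ∀ φ : TestFn, w (TestFn.toC0 φ) = d2Pairing f φ := by
  have hinj : Function.Injective TestFn.toC0 := fun φ ψ h => by
    ext t
    simpa using DFunLike.congr_fun h t
  let l : TestFn →ₗ[ℝ] ℝ :=
    { toFun := d2Pairing f
      map_add' := d2Pairing_add_right f.2.1
      map_smul' := d2Pairing_smul_right f }
  let e := LinearEquiv.ofInjective TestFn.toC0 hinj
  have he : ∀ φ : TestFn, e.symm ⟨TestFn.toC0 φ, φ, rfl⟩ = φ := fun φ => by
    rw [LinearEquiv.symm_apply_eq]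
    rfl
  have hb : ∀ v : LinearMap.range TestFn.toC0,
      ‖(l ∘ₗ e.symm.toLinearMap) v‖ ≤ (TV2 f).toReal * ‖v‖ := by
    rintro ⟨_, φ, rfl⟩
    change |d2Pairing f (e.symm ⟨TestFn.toC0 φ, φ, rfl⟩)| ≤ _
    rw [he]
    exact abs_d2Pairing_le f.2.2 φ
  let u : StrongDual ℝ (LinearMap.range TestFn.toC0) :=
    LinearMap.mkContinuous (σ := RingHom.id ℝ) (E := LinearMap.range TestFn.toC0) (F := ℝ)
      (l ∘ₗ e.symm.toLinearMap) (TV2 f).toReal hb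
  obtain ⟨w, hw, -⟩ := exists_extension_norm_eq (LinearMap.range TestFn.toC0) u
  have hw' : ∀ φ : TestFn, w (TestFn.toC0 φ) = d2Pairing f φ := fun φ => by
    have h1 := hw ⟨TestFn.toC0 φ, φ, rfl⟩
    have h2 : u ⟨TestFn.toC0 φ, φ, rfl⟩ = d2Pairing f (e.symm ⟨TestFn.toC0 φ, φ, rfl⟩) := rfl
    rw [h2, he] at h1
    exact h1
  refine ⟨w, hw', fun w' h' => ?_⟩
  refine DFunLike.coe_injective (TestFn.denseRange_toC0.equalizer w'.continuous w.continuous ?_)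
  funext φ
  exact (h' φ).trans (hw' φ).symm

/-- The second derivative `D² f ∈ 𝓜(ℝ) = C₀(ℝ)'` of `f ∈ BV⁽²⁾(ℝ)`. -/
noncomputable def weakD2 (f : BV2) : StrongDual ℝ C₀(ℝ, ℝ) :=
  (existsUnique_weakD2 f).choose

/-- The weak-* topology of `BV⁽²⁾(ℝ)`. The linear bijection `f ↦ (D² f, f 0, f 1)` identifies
`BV⁽²⁾(ℝ)`, with the norm `TV⁽²⁾(f) + |f 0| + |f 1|`, with `𝓜(ℝ) × ℝ × ℝ`, which is the dual of
the Banach space `C₀(ℝ) × ℝ × ℝ`; the topology is the weak-* topology of this dual. -/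
@[reducible] noncomputable def BV2.weakStar : TopologicalSpace BV2 :=
  TopologicalSpace.induced
    (fun f => ((StrongDual.toWeakDual (weakD2 f) : WeakDual ℝ C₀(ℝ, ℝ)),
      (f : ℝ → ℝ) 0, (f : ℝ → ℝ) 1)) inferInstance

/-- Compactness for the weak-* topology of `BV⁽²⁾(ℝ)`. -/
def IsWeakStarCompact (V : Set BV2) : Prop :=
  @IsCompact BV2 BV2.weakStar V

/-- The Lipschitz constant `L(f) = sup_{x₁ ≠ x₂} |f x₁ - f x₂| / |x₁ - x₂| ∈ [0, ∞]`. -/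
noncomputable def lipConst (f : ℝ → ℝ) : ℝ≥0∞ :=
  ⨆ (x₁ : ℝ) (x₂ : ℝ) (_ : x₁ ≠ x₂), ENNReal.ofReal (|f x₁ - f x₂| / |x₁ - x₂|)

/-- The objective `∑ₘ E(f(xₘ), yₘ) + lam · TV⁽²⁾(f)` on `BV⁽²⁾(ℝ)`. -/
noncomputable def hybridCost {M : ℕ} (E : ℝ → ℝ → ℝ) (x y : Fin M → ℝ) (lam : ℝ) (f : BV2) : ℝ :=
  ∑ m, E ((f : ℝ → ℝ) (x m)) (y m) + lam * (TV2 f).toReal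

/-- The solution set of the Lipschitz-constrained problem: minimizers of the objective over
all `f ∈ BV⁽²⁾(ℝ)` with `L(f) ≤ Lbar`. -/
def hybridSolutions {M : ℕ} (E : ℝ → ℝ → ℝ) (x y : Fin M → ℝ) (lam Lbar : ℝ) : Set BV2 :=
  {f | lipConst f ≤ ENNReal.ofReal Lbar ∧
    ∀ g : BV2, lipConst g ≤ ENNReal.ofReal Lbar →
      hybridCost E x y lam f ≤ hybridCost E x y lam g}

/-- The `TV⁽²⁾`-minimal interpolants of the points `(xₘ, zₘ)` in `BV⁽²⁾(ℝ)`. -/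
def tv2Interpolants {M : ℕ} (x z : Fin M → ℝ) : Set BV2 :=
  {f | (∀ m, (f : ℝ → ℝ) (x m) = z m) ∧
    ∀ g : BV2, (∀ m, (g : ℝ → ℝ) (x m) = z m) → TV2 f ≤ TV2 g}

/-- `f` is a linear spline with at most `N` linear regions: it is continuous, and there is a finite
set `T` of knots, cutting the line into `|T| + 1 ≤ N` intervals, such that `f` is affine on every
interval that contains no knot. -/
def IsLinearSpline (f : ℝ → ℝ) (N : ℕ) : Prop :=
  Continuous f ∧ ∃ T : Finset ℝ, T.card + 1 ≤ N ∧
    ∀ I : Set ℝ, I.OrdConnected → Disjoint I (T : Set ℝ) →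
      ∃ a b : ℝ, ∀ t ∈ I, f t = a * t + b

/-- The sum of absolute slope differences
`∑_{m=2}^{M-1} |(zₘ - zₘ₋₁)/(xₘ - xₘ₋₁) - (zₘ - zₘ₊₁)/(xₘ - xₘ₊₁)|`. Here `xₘ` is `x (m - 1)`,
and the summation index is `i = m - 2`. -/
noncomputable def slopeVariation {M : ℕ} (x z : Fin M → ℝ) : ℝ :=
  ∑ i : Fin (M - 2),
    let p : Fin M := ⟨i, by omega⟩
    let c : Fin M := ⟨i + 1, by omega⟩
    let n : Fin M := ⟨i + 2, by omega⟩
    |(z c - z p) / (x c - x p) - (z c - z n) / (x c - x n)|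

/-!
A function `f` of `BV⁽²⁾(ℝ)` is recovered from `D² f` and two of its values: the error of linear
interpolation is the pairing of `D² f` with a Peano kernel, and this describes the weak-* topology.

Pairing `D² f` with the hat functions at the interior nodes gives the slope jumps of the data.
Signed combinations of these hats are bounded by one, so `slopeVariation` is a lower bound for
`‖D² f‖`; the piecewise linear interpolant attains it, and hence every minimal interpolant of the
same data does. On a minimal interpolant the hats compute the norm of `D² f`, so that additional
nodes do not increase the variation of the slopes. This confines all its slopes to the range of the
slopes of the data, and the Lipschitz constraint becomes a constraint on the data.

The values at the nodes of a hybrid solution therefore minimize a strictly convex and coercive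
function over a closed convex set in `ℝᴹ`. They are unique, and the hybrid solutions are exactly
the minimal interpolants of these values.

At an extreme minimal interpolant `f`, a function `ρ` for which the measure `ρ D² f` annihilates
the `M - 2` hats satisfies `ρ D² f = 0`, since otherwise `f` could be moved in the two directions
with second derivative `± ρ D² f`. So `D² f` has at most `M - 2` atoms and no other part.
-/

section

open Filter MeasureTheory Set
open scoped Convolution

/-! ### The second derivative as a functional -/

theorem weakD2_toC0 (f : BV2) (φ : TestFn) : weakD2 f (TestFn.toC0 φ) = d2Pairing f φ :=
  (existsUnique_weakD2 f).choose_spec.1 φ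

theorem weakD2_eq_of_forall {f : BV2} {w : StrongDual ℝ C₀(ℝ, ℝ)}
    (h : ∀ φ : TestFn, w (TestFn.toC0 φ) = d2Pairing f φ) : weakD2 f = w :=
  (existsUnique_weakD2 f).unique (weakD2_toC0 f) h

theorem isLinearMap_weakD2 : IsLinearMap ℝ weakD2 where
  map_add f g := weakD2_eq_of_forall fun φ => by
    rw [add_apply, weakD2_toC0, weakD2_toC0]
    exact (d2Pairing_add_left f.2.1 g.2.1 φ).symm
  map_smul c f := weakD2_eq_of_forall fun φ => by
    rw [smul_apply, weakD2_toC0]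
    exact (d2Pairing_smul_left c f φ).symm

theorem norm_weakD2_le (f : BV2) : ‖weakD2 f‖ ≤ (TV2 f).toReal := by
  refine ContinuousLinearMap.opNorm_le_bound _ ENNReal.toReal_nonneg fun g => ?_
  refine TestFn.denseRange_toC0.induction_on (p := fun g => ‖weakD2 f g‖ ≤ (TV2 f).toReal * ‖g‖) g
    (isClosed_le (by fun_prop) (by fun_prop)) fun φ => ?_
  rw [weakD2_toC0]
  exact abs_d2Pairing_le f.2.2 φ

theorem TV2_le_of_forall {f : ℝ → ℝ} {w : StrongDual ℝ C₀(ℝ, ℝ)}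
    (h : ∀ φ : TestFn, w (TestFn.toC0 φ) = d2Pairing f φ) : TV2 f ≤ ENNReal.ofReal ‖w‖ := by
  refine iSup₂_le fun φ hφ => ENNReal.ofReal_le_ofReal ?_
  rw [← h]
  simpa [hφ] using (le_abs_self _).trans (w.le_opNorm (TestFn.toC0 φ))

theorem TV2_eq_ofReal_norm (f : BV2) : TV2 f = ENNReal.ofReal ‖weakD2 f‖ :=
  le_antisymm (TV2_le_of_forall (weakD2_toC0 f)) <| by
    rw [← ENNReal.ofReal_toReal f.2.2.ne]
    exact ENNReal.ofReal_le_ofReal (norm_weakD2_le f)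

theorem toReal_TV2 (f : BV2) : (TV2 f).toReal = ‖weakD2 f‖ := by
  rw [TV2_eq_ofReal_norm, ENNReal.toReal_ofReal (norm_nonneg (weakD2 f))]

theorem TV2_le_TV2_iff (f g : BV2) : TV2 f ≤ TV2 g ↔ ‖weakD2 f‖ ≤ ‖weakD2 g‖ := by
  rw [TV2_eq_ofReal_norm, TV2_eq_ofReal_norm, ENNReal.ofReal_le_ofReal_iff (norm_nonneg (weakD2 g))]

/-! ### The norm of `C₀(ℝ)` and of its dual -/

theorem norm_c0_le {g : C₀(ℝ, ℝ)} {C : ℝ} (hC : 0 ≤ C) (h : ∀ t, |g t| ≤ C) : ‖g‖ ≤ C := by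
  rw [← ZeroAtInftyContinuousMap.norm_toBCF_eq_norm]
  exact (BoundedContinuousFunction.norm_le hC).2 h

theorem abs_c0_apply_le (g : C₀(ℝ, ℝ)) (t : ℝ) : |g t| ≤ ‖g‖ := by
  rw [← ZeroAtInftyContinuousMap.norm_toBCF_eq_norm]
  exact g.toBCF.norm_coe_le_norm t

/-- Evaluation at `t` as a functional on `C₀(ℝ)`, that is, the Dirac mass at `t`. -/
noncomputable def dirac (t : ℝ) : StrongDual ℝ C₀(ℝ, ℝ) :=
  LinearMap.mkContinuous (σ := RingHom.id ℝ) (E := C₀(ℝ, ℝ)) (F := ℝ)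
    { toFun := fun g => g t
      map_add' := fun _ _ => rfl
      map_smul' := fun _ _ => rfl } 1 fun g => by
    rw [one_mul]
    exact abs_c0_apply_le g t

@[simp] theorem dirac_apply (t : ℝ) (g : C₀(ℝ, ℝ)) : dirac t g = g t := rfl

theorem c0_sum_smul_apply {ι : Type*} (s : Finset ι) (c : ι → ℝ) (g : ι → C₀(ℝ, ℝ)) (t : ℝ) :
    (∑ i ∈ s, c i • g i) t = ∑ i ∈ s, c i * g i t := by
  rw [← dirac_apply, map_sum]
  simp only [map_smul, dirac_apply, smul_eq_mul]

theorem dual_apply_le_norm (w : StrongDual ℝ C₀(ℝ, ℝ)) {η : C₀(ℝ, ℝ)} (hη : ∀ t, |η t| ≤ 1) :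
    w η ≤ ‖w‖ :=
  (le_abs_self _).trans (w.unit_le_opNorm η (norm_c0_le zero_le_one hη))

theorem norm_dual_le_of_forall {w : StrongDual ℝ C₀(ℝ, ℝ)} {C : ℝ} (hC : 0 ≤ C)
    (h : ∀ η : C₀(ℝ, ℝ), (∀ t, |η t| ≤ 1) → w η ≤ C) : ‖w‖ ≤ C := by
  refine w.opNorm_le_of_unit_norm hC fun η hη => ?_
  have hη' : ∀ t, |η t| ≤ 1 := fun t => (abs_c0_apply_le η t).trans_eq hη
  refine abs_le.2 ⟨?_, h η hη'⟩
  have := h (-η) fun t => by simpa using hη' t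
  rw [map_neg] at this
  linarith

/-! ### Integrals against the second derivative of a test function -/

theorem TestFn.iteratedDeriv_two (φ : TestFn) :
    iteratedDeriv 2 (φ : ℝ → ℝ) = deriv (deriv φ) := by
  rw [iteratedDeriv_succ, iteratedDeriv_one]

theorem TestFn.contDiff_deriv (φ : TestFn) : ContDiff ℝ (⊤ : ℕ∞) (deriv (φ : ℝ → ℝ)) :=
  (contDiff_infty_iff_deriv.1 φ.contDiff').2

theorem TestFn.deriv_sub_mul_deriv (φ : TestFn) (t : ℝ) :
    deriv (fun x => (x - t) * deriv φ x - φ x) = fun x => (x - t) * iteratedDeriv 2 φ x := by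
  funext x
  have h₁ : HasDerivAt φ (deriv φ x) x :=
    (φ.contDiff'.differentiable (by simp)).differentiableAt.hasDerivAt
  have h₂ : HasDerivAt (deriv φ) (deriv (deriv φ) x) x :=
    (φ.contDiff_deriv.differentiable (by simp)).differentiableAt.hasDerivAt
  rw [φ.iteratedDeriv_two]
  refine (((((hasDerivAt_id x).sub_const t).mul h₂).sub h₁).congr_deriv ?_).deriv
  simp

theorem TestFn.contDiff_sub_mul_deriv (φ : TestFn) (t : ℝ) :
    ContDiff ℝ 1 (fun x => (x - t) * deriv φ x - φ x) :=
  (((contDiff_id.sub contDiff_const).mul φ.contDiff_deriv).sub φ.contDiff').of_le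
    (by exact_mod_cast le_top)

theorem TestFn.hasCompactSupport_sub_mul_deriv (φ : TestFn) (t : ℝ) :
    HasCompactSupport (fun x => (x - t) * deriv φ x - φ x) :=
  (φ.hasCompactSupport'.deriv.mul_left (f := fun x => x - t)).sub φ.hasCompactSupport'

theorem TestFn.integral_Ioi_sub_mul_d2 (φ : TestFn) (t : ℝ) :
    ∫ x in Ioi t, (x - t) * iteratedDeriv 2 φ x = φ t := by
  rw [← φ.deriv_sub_mul_deriv t, HasCompactSupport.integral_Ioi_deriv_eq
    (φ.contDiff_sub_mul_deriv t) (φ.hasCompactSupport_sub_mul_deriv t)]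
  simp

theorem TestFn.integral_Iic_sub_mul_d2 (φ : TestFn) (t : ℝ) :
    ∫ x in Iic t, (x - t) * iteratedDeriv 2 φ x = -φ t := by
  rw [← φ.deriv_sub_mul_deriv t, HasCompactSupport.integral_Iic_deriv_eq
    (φ.contDiff_sub_mul_deriv t) (φ.hasCompactSupport_sub_mul_deriv t)]
  simp

theorem d2Pairing_sub_const (t : ℝ) (φ : TestFn) : d2Pairing (fun x => x - t) φ = 0 := by
  have hi : Integrable (fun x => (x - t) * iteratedDeriv 2 φ x) :=
    integrable_mul_d2 (f := fun x => x - t) (by fun_prop) φ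
  rw [d2Pairing, ← intervalIntegral.integral_Iic_add_Ioi hi.integrableOn hi.integrableOn,
    φ.integral_Iic_sub_mul_d2, φ.integral_Ioi_sub_mul_d2, neg_add_cancel]

theorem d2Pairing_affine (a b : ℝ) (φ : TestFn) : d2Pairing (fun x => a * x + b) φ = 0 := by
  have h : (fun x : ℝ => a * x + b)
      = (a + b) • (fun x : ℝ => x - 0) + (-b) • (fun x : ℝ => x - 1) := by
    funext x
    simp only [Pi.add_apply, Pi.smul_apply, smul_eq_mul]
    ring
  rw [h, d2Pairing_add_left (by fun_prop) (by fun_prop), d2Pairing_smul_left, d2Pairing_smul_left,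
    d2Pairing_sub_const, d2Pairing_sub_const]
  simp

theorem d2Pairing_add_affine {f : ℝ → ℝ} (hf : Continuous f) (a b : ℝ) (φ : TestFn) :
    d2Pairing (f + fun x => a * x + b) φ = d2Pairing f φ := by
  rw [d2Pairing_add_left hf (by fun_prop), d2Pairing_affine, add_zero]

/-! ### Ramps and Peano kernels -/

/-- The ramp `x ↦ (x - t)₊` with knot `t`, whose second derivative is the Dirac mass at `t`. -/
noncomputable def ramp (t x : ℝ) : ℝ := max (x - t) 0

theorem continuous_ramp (t : ℝ) : Continuous (ramp t) := by
  unfold ramp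
  fun_prop

theorem ramp_of_le {t x : ℝ} (h : t ≤ x) : ramp t x = x - t := max_eq_left (sub_nonneg.2 h)

theorem ramp_of_ge {t x : ℝ} (h : x ≤ t) : ramp t x = 0 := max_eq_right (sub_nonpos.2 h)

theorem abs_ramp_sub_le (t x y : ℝ) : |ramp t x - ramp t y| ≤ |x - y| := by
  simpa [ramp] using abs_max_sub_max_le_abs (x - t) (y - t) 0

theorem monotone_ramp (t : ℝ) : Monotone (ramp t) := fun _ _ h =>
  max_le_max_right 0 (sub_le_sub_right h t)

theorem d2Pairing_ramp (t : ℝ) (φ : TestFn) : d2Pairing (ramp t) φ = φ t := by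
  have h : (fun x => ramp t x * iteratedDeriv 2 φ x)
      = (Ioi t).indicator (fun x => (x - t) * iteratedDeriv 2 φ x) := by
    funext x
    rcases lt_or_ge t x with hx | hx
    · rw [indicator_of_mem (mem_Ioi.2 hx), ramp_of_le hx.le]
    · rw [indicator_of_notMem (notMem_Ioi.2 hx), ramp_of_ge hx, zero_mul]
  rw [d2Pairing, h, integral_indicator measurableSet_Ioi, φ.integral_Ioi_sub_mul_d2]

theorem slope_ramp_nonneg (t a b : ℝ) : 0 ≤ slope (ramp t) a b :=
  ((monotone_ramp t).monotoneOn univ).slope_nonneg (mem_univ a) (mem_univ b)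

theorem slope_ramp_le_one (t a b : ℝ) : slope (ramp t) a b ≤ 1 := by
  rw [slope_def_field]
  refine (le_abs_self _).trans ?_
  rw [abs_div]
  exact div_le_one_of_le₀ (abs_ramp_sub_le t b a) (abs_nonneg _)

theorem slope_ramp_of_le {t a b : ℝ} (hab : a ≠ b) (ha : t ≤ a) (hb : t ≤ b) :
    slope (ramp t) a b = 1 := by
  rw [slope_def_field, ramp_of_le ha, ramp_of_le hb, sub_sub_sub_cancel_right,
    div_self (sub_ne_zero.2 hab.symm)]

theorem slope_ramp_of_ge {t a b : ℝ} (ha : a ≤ t) (hb : b ≤ t) : slope (ramp t) a b = 0 := by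
  rw [slope_def_field, ramp_of_ge ha, ramp_of_ge hb, sub_self, zero_div]

/-- The Peano kernel of linear interpolation at the nodes `p` and `q`: the error at `x` of the
linear interpolant of the ramp with knot `t`. -/
noncomputable def peanoKernel (p q x t : ℝ) : ℝ :=
  ramp t x - ramp t p - slope (ramp t) p q * (x - p)

theorem continuous_peanoKernel (p q x : ℝ) : Continuous (peanoKernel p q x) := by
  unfold peanoKernel ramp slope
  fun_prop

theorem hasCompactSupport_peanoKernel {p q : ℝ} (hpq : p ≠ q) (x : ℝ) :
    HasCompactSupport (peanoKernel p q x) := by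
  refine HasCompactSupport.intro (isCompact_Icc (a := min x (min p q)) (b := max x (max p q)))
    fun t ht => ?_
  rw [mem_Icc, not_and_or, not_le, not_le, lt_min_iff, lt_min_iff, max_lt_iff, max_lt_iff] at ht
  rcases ht with ⟨hx, hp, hq⟩ | ⟨hx, hp, hq⟩
  · rw [peanoKernel, ramp_of_le hx.le, ramp_of_le hp.le, slope_ramp_of_le hpq hp.le hq.le]
    ring
  · rw [peanoKernel, ramp_of_ge hx.le, ramp_of_ge hp.le, slope_ramp_of_ge hp.le hq.le]
    ring

theorem abs_peanoKernel_sub_le (p q x y t : ℝ) :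
    |peanoKernel p q x t - peanoKernel p q y t| ≤ 2 * |x - y| := by
  have hs : |slope (ramp t) p q| ≤ 1 := abs_le.2
    ⟨by linarith [slope_ramp_nonneg t p q], slope_ramp_le_one t p q⟩
  calc |peanoKernel p q x t - peanoKernel p q y t|
      = |(ramp t x - ramp t y) - slope (ramp t) p q * (x - y)| := by
        unfold peanoKernel
        ring_nf
    _ ≤ |ramp t x - ramp t y| + |slope (ramp t) p q| * |x - y| := by
        rw [← abs_mul]
        exact abs_sub _ _
    _ ≤ |x - y| + 1 * |x - y| := by
        exact add_le_add (abs_ramp_sub_le t x y) (mul_le_mul_of_nonneg_right hs (abs_nonneg _))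
    _ = 2 * |x - y| := by ring

theorem d2Pairing_peanoKernel (p q t : ℝ) (φ : TestFn) :
    d2Pairing (fun x => peanoKernel p q x t) φ = φ t := by
  rw [← d2Pairing_ramp t φ, ← d2Pairing_add_affine (continuous_ramp t) (-slope (ramp t) p q)
    (slope (ramp t) p q * p - ramp t p)]
  congr 1
  funext x
  simp only [peanoKernel, Pi.add_apply]
  ring

/-- The Peano kernel as an element of `C₀(ℝ)`. -/
noncomputable def peanoC0 {p q : ℝ} (hpq : p ≠ q) (x : ℝ) : C₀(ℝ, ℝ) where
  toFun := peanoKernel p q x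
  continuous_toFun := continuous_peanoKernel p q x
  zero_at_infty' := (hasCompactSupport_peanoKernel hpq x).is_zero_at_infty

@[simp] theorem peanoC0_apply {p q : ℝ} (hpq : p ≠ q) (x t : ℝ) :
    peanoC0 hpq x t = peanoKernel p q x t := rfl

theorem continuous_peanoC0 {p q : ℝ} (hpq : p ≠ q) : Continuous (peanoC0 hpq) := by
  refine (LipschitzWith.of_dist_le_mul (K := 2) fun x y => ?_).continuous
  rw [dist_eq_norm, Real.dist_eq]
  exact norm_c0_le (by positivity) (abs_peanoKernel_sub_le p q x y)

theorem peanoC0_left {p q : ℝ} (hpq : p ≠ q) : peanoC0 hpq p = 0 := by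
  ext t
  simp [peanoKernel]

theorem peanoC0_right {p q : ℝ} (hpq : p ≠ q) : peanoC0 hpq q = 0 := by
  ext t
  have hslope : (q - p) * slope (ramp t) p q = ramp t q - ramp t p := sub_smul_slope (ramp t) p q
  change peanoKernel p q q t = 0
  rw [peanoKernel, mul_comm, hslope, sub_self]

theorem integrable_d2_smul_peanoC0 {p q : ℝ} (hpq : p ≠ q) (φ : TestFn) :
    Integrable (fun x => iteratedDeriv 2 φ x • peanoC0 hpq x) :=
  (φ.continuous_d2.smul (continuous_peanoC0 hpq)).integrable_of_hasCompactSupport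
    φ.hasCompactSupport_d2.smul_right

theorem integral_d2_smul_peanoC0 {p q : ℝ} (hpq : p ≠ q) (φ : TestFn) :
    ∫ x, iteratedDeriv 2 φ x • peanoC0 hpq x = TestFn.toC0 φ := by
  ext t
  rw [← dirac_apply, ← (dirac t).integral_comp_comm (integrable_d2_smul_peanoC0 hpq φ),
    TestFn.toC0_apply, ← d2Pairing_peanoKernel p q t φ, d2Pairing]
  simp [mul_comm]

/-! ### Recovering a function from its second derivative and two values -/

/-- The function with values `A` at `p` and `B` at `q` and second derivative `w`: the linear
interpolant of the two values plus the Peano remainder. -/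
noncomputable def d2Inverse {p q : ℝ} (hpq : p ≠ q) (A B : ℝ) (w : StrongDual ℝ C₀(ℝ, ℝ))
    (x : ℝ) : ℝ :=
  A + (B - A) / (q - p) * (x - p) + w (peanoC0 hpq x)

theorem continuous_apply_peanoC0 {p q : ℝ} (hpq : p ≠ q) (w : StrongDual ℝ C₀(ℝ, ℝ)) :
    Continuous fun x => w (peanoC0 hpq x) :=
  w.continuous.comp (continuous_peanoC0 hpq)

theorem continuous_d2Inverse {p q : ℝ} (hpq : p ≠ q) (A B : ℝ) (w : StrongDual ℝ C₀(ℝ, ℝ)) :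
    Continuous (d2Inverse hpq A B w) :=
  (by fun_prop : Continuous fun x => A + (B - A) / (q - p) * (x - p)).add
    (continuous_apply_peanoC0 hpq w)

theorem d2Pairing_apply_peanoC0 {p q : ℝ} (hpq : p ≠ q) (w : StrongDual ℝ C₀(ℝ, ℝ))
    (φ : TestFn) : d2Pairing (fun x => w (peanoC0 hpq x)) φ = w (TestFn.toC0 φ) := by
  rw [← integral_d2_smul_peanoC0 hpq φ, ← w.integral_comp_comm (integrable_d2_smul_peanoC0 hpq φ),
    d2Pairing]
  simp [mul_comm]

theorem d2Pairing_d2Inverse {p q : ℝ} (hpq : p ≠ q) (A B : ℝ) (w : StrongDual ℝ C₀(ℝ, ℝ))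
    (φ : TestFn) : w (TestFn.toC0 φ) = d2Pairing (d2Inverse hpq A B w) φ := by
  have h : d2Inverse hpq A B w = (fun x => w (peanoC0 hpq x))
      + fun x => (B - A) / (q - p) * x + (A - (B - A) / (q - p) * p) := by
    funext x
    simp only [d2Inverse, Pi.add_apply]
    ring
  rw [h, d2Pairing_add_affine (continuous_apply_peanoC0 hpq w), d2Pairing_apply_peanoC0]

/-- `d2Inverse` as an element of `BV⁽²⁾(ℝ)`. -/
noncomputable def BV2.ofD2 {p q : ℝ} (hpq : p ≠ q) (A B : ℝ) (w : StrongDual ℝ C₀(ℝ, ℝ)) : BV2 :=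
  ⟨d2Inverse hpq A B w, continuous_d2Inverse hpq A B w,
    (TV2_le_of_forall (d2Pairing_d2Inverse hpq A B w)).trans_lt ENNReal.ofReal_lt_top⟩

theorem BV2.ofD2_apply {p q : ℝ} (hpq : p ≠ q) (A B : ℝ) (w : StrongDual ℝ C₀(ℝ, ℝ)) (x : ℝ) :
    (BV2.ofD2 hpq A B w).1 x = A + (B - A) / (q - p) * (x - p) + w (peanoC0 hpq x) := rfl

theorem weakD2_ofD2 {p q : ℝ} (hpq : p ≠ q) (A B : ℝ) (w : StrongDual ℝ C₀(ℝ, ℝ)) :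
    weakD2 (BV2.ofD2 hpq A B w) = w :=
  weakD2_eq_of_forall (d2Pairing_d2Inverse hpq A B w)

theorem BV2.ofD2_left {p q : ℝ} (hpq : p ≠ q) (A B : ℝ) (w : StrongDual ℝ C₀(ℝ, ℝ)) :
    (BV2.ofD2 hpq A B w).1 p = A := by
  simp [BV2.ofD2_apply, peanoC0_left]

theorem BV2.ofD2_right {p q : ℝ} (hpq : p ≠ q) (A B : ℝ) (w : StrongDual ℝ C₀(ℝ, ℝ)) :
    (BV2.ofD2 hpq A B w).1 q = B := by
  simp [BV2.ofD2_apply, peanoC0_right, sub_ne_zero.2 hpq.symm]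

theorem exists_eq_affine_of_hasDerivAt_zero {g g' : ℝ → ℝ} (hg : ∀ x, HasDerivAt g (g' x) x)
    (hg' : ∀ x, HasDerivAt g' 0 x) : ∃ a b : ℝ, ∀ x, g x = a * x + b := by
  have hconst : ∀ x, g' x = g' 0 := fun x =>
    is_const_of_deriv_eq_zero (fun y => (hg' y).differentiableAt) (fun y => (hg' y).deriv) x 0
  have hd : ∀ x, HasDerivAt (fun y => g y - g' 0 * y) 0 x := fun x =>
    ((hg x).sub ((hasDerivAt_id x).const_mul (g' 0))).congr_deriv (by simp [hconst x])
  refine ⟨g' 0, g 0, fun x => ?_⟩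
  have := is_const_of_deriv_eq_zero (fun y => (hd y).differentiableAt) (fun y => (hd y).deriv) x 0
  simp only [mul_zero, sub_zero] at this
  linarith

/-- The test function `t ↦ φ (x - t)`, against which `f` is integrated in the convolution `φ ⋆ f`
at `x`. -/
noncomputable def TestFn.reflect (φ : TestFn) (x : ℝ) : TestFn where
  toFun t := φ (x - t)
  contDiff' := φ.contDiff'.comp (contDiff_const.sub contDiff_id)
  hasCompactSupport' := φ.hasCompactSupport'.comp_homeomorph (Homeomorph.subLeft x)
  tsupport_subset' _ _ := trivial

theorem TestFn.d2_reflect (φ : TestFn) (x t : ℝ) :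
    iteratedDeriv 2 (φ.reflect x) t = deriv (deriv φ) (x - t) := by
  change iteratedDeriv 2 (fun t => φ (x - t)) t = _
  rw [iteratedDeriv_comp_const_sub, φ.iteratedDeriv_two]
  simp

theorem convolution_eq_affine_of_d2Pairing_eq_zero {f : ℝ → ℝ} (hf : Continuous f)
    (h : ∀ φ : TestFn, d2Pairing f φ = 0) (φ : TestFn) :
    ∃ a b : ℝ, ∀ x, (φ ⋆[ContinuousLinearMap.lsmul ℝ ℝ] f) x = a * x + b := by
  refine exists_eq_affine_of_hasDerivAt_zero
    (g' := deriv φ ⋆[ContinuousLinearMap.lsmul ℝ ℝ] f)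
    (fun x => φ.hasCompactSupport'.hasDerivAt_convolution_left _
      (φ.contDiff'.of_le (by exact_mod_cast le_top)) hf.locallyIntegrable x)
    (fun x => (φ.hasCompactSupport'.deriv.hasDerivAt_convolution_left _
      (φ.contDiff_deriv.of_le (by exact_mod_cast le_top)) hf.locallyIntegrable x).congr_deriv ?_)
  rw [convolution_eq_swap, ← h (φ.reflect x), d2Pairing]
  simp [φ.d2_reflect, mul_comm]

/-- A normalized bump function as a test function. -/
noncomputable def TestFn.ofBump (b : ContDiffBump (0 : ℝ)) : TestFn where
  toFun := b.normed volume
  contDiff' := b.contDiff_normed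
  hasCompactSupport' := b.hasCompactSupport_normed
  tsupport_subset' _ _ := trivial

theorem eq_affine_of_d2Pairing_eq_zero {f : ℝ → ℝ} (hf : Continuous f)
    (h : ∀ φ : TestFn, d2Pairing f φ = 0) (x : ℝ) : f x = (f 1 - f 0) * x + f 0 := by
  let b : ℕ → ContDiffBump (0 : ℝ) := fun n =>
    ⟨1 / (n + 1) / 2, 1 / (n + 1), by positivity, half_lt_self (by positivity)⟩
  have hlim := ContDiffBump.convolution_tendsto_right_of_continuous (μ := volume) (φ := b)
    tendsto_one_div_add_atTop_nhds_zero_nat hf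
  refine tendsto_nhds_unique (hlim x)
    (((((hlim 1).sub (hlim 0)).mul_const x).add (hlim 0)).congr fun n => ?_)
  obtain ⟨a, c, hac⟩ := convolution_eq_affine_of_d2Pairing_eq_zero hf h (TestFn.ofBump (b n))
  change ∀ x, ((b n).normed volume ⋆[ContinuousLinearMap.lsmul ℝ ℝ] f) x = a * x + c at hac
  simp only [hac]
  ring

theorem BV2.eq_affine_of_weakD2_eq_zero {f : BV2} (hf : weakD2 f = 0) (x : ℝ) :
    f.1 x = (f.1 1 - f.1 0) * x + f.1 0 :=
  eq_affine_of_d2Pairing_eq_zero f.2.1 (fun φ => by rw [← weakD2_toC0, hf, zero_apply]) x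

theorem BV2.eq_of_weakD2_eq {f g : BV2} {p q : ℝ} (hpq : p ≠ q) (hw : weakD2 f = weakD2 g)
    (hp : f.1 p = g.1 p) (hq : f.1 q = g.1 q) : f = g := by
  rw [← sub_eq_zero] at hw hp hq ⊢
  rw [← isLinearMap_weakD2.map_sub] at hw
  have haff := BV2.eq_affine_of_weakD2_eq_zero hw
  set d : BV2 := f - g
  change d.1 p = 0 at hp
  change d.1 q = 0 at hq
  rw [haff] at hp hq
  have hslope : d.1 1 - d.1 0 = 0 := by
    refine (mul_eq_zero.1 ?_).resolve_right (sub_ne_zero.2 hpq)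
    linarith
  refine Subtype.ext (funext fun x => ?_)
  change d.1 x = 0
  rw [hslope, zero_mul, zero_add] at hp
  rw [haff, hslope, zero_mul, zero_add, hp]

theorem BV2.eq_ofD2 {p q : ℝ} (hpq : p ≠ q) (f : BV2) :
    f = BV2.ofD2 hpq (f.1 p) (f.1 q) (weakD2 f) :=
  BV2.eq_of_weakD2_eq hpq (weakD2_ofD2 hpq _ _ _).symm (BV2.ofD2_left hpq _ _ _).symm
    (BV2.ofD2_right hpq _ _ _).symm

theorem BV2.apply_eq {p q : ℝ} (hpq : p ≠ q) (f : BV2) (x : ℝ) :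
    f.1 x = f.1 p + (f.1 q - f.1 p) / (q - p) * (x - p) + weakD2 f (peanoC0 hpq x) :=
  congrFun (congrArg Subtype.val (BV2.eq_ofD2 hpq f)) x

/-! ### Hat functions and secant slopes -/

/-- The hat function with nodes `a < b < c`, written as the difference of the slopes over `[b, c]`
and `[a, b]` of `x ↦ peanoC0 _ x`: pairing it with a second derivative gives the difference of
these slopes (`weakD2_hat`). The nodes `0 ≠ 1` of the Peano kernel are arbitrary. -/
noncomputable def hat (a b c : ℝ) : C₀(ℝ, ℝ) :=
  slope (peanoC0 (zero_ne_one' ℝ)) b c - slope (peanoC0 (zero_ne_one' ℝ)) a b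

theorem slope_add_affine {a b : ℝ} (hab : a ≠ b) (g : ℝ → ℝ) (m x₀ k : ℝ) :
    slope (fun x => k + m * (x - x₀) + g x) a b = m + slope g a b := by
  have := sub_ne_zero.2 hab.symm
  rw [slope_def_field, slope_def_field]
  field_simp
  ring

theorem weakD2_hat {a b c : ℝ} (hab : a ≠ b) (hbc : b ≠ c) (f : BV2) :
    weakD2 f (hat a b c) = slope f.1 b c - slope f.1 a b := by
  have hslope : ∀ {u v : ℝ}, u ≠ v → slope f.1 u v
      = (f.1 1 - f.1 0) / (1 - 0) + weakD2 f (slope (peanoC0 (zero_ne_one' ℝ)) u v) := by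
    intro u v huv
    conv_lhs => rw [funext (BV2.apply_eq (zero_ne_one' ℝ) f)]
    rw [slope_add_affine huv]
    congr 1
    exact (weakD2 f).toLinearMap.slope_comp _ u v
  rw [hat, map_sub, hslope hab, hslope hbc]
  ring

theorem hat_apply {a b c : ℝ} (hab : a ≠ b) (hbc : b ≠ c) (t : ℝ) :
    hat a b c t = slope (ramp t) b c - slope (ramp t) a b := by
  have hslope : ∀ {u v : ℝ}, u ≠ v → slope (peanoC0 (zero_ne_one' ℝ)) u v t
      = -slope (ramp t) 0 1 + slope (ramp t) u v := by
    intro u v huv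
    rw [← slope_add_affine huv (ramp t) (-slope (ramp t) 0 1) 0 (-ramp t 0)]
    refine ((dirac t).toLinearMap.slope_comp (peanoC0 (zero_ne_one' ℝ)) u v).symm.trans ?_
    congr 1
    funext x
    change peanoKernel 0 1 x t = _
    rw [peanoKernel]
    ring
  rw [hat, ZeroAtInftyContinuousMap.sub_apply, hslope hab, hslope hbc]
  ring

theorem hat_apply_center {a b c : ℝ} (hab : a < b) (hbc : b < c) : hat a b c b = 1 := by
  rw [hat_apply hab.ne hbc.ne, slope_ramp_of_le hbc.ne le_rfl hbc.le,
    slope_ramp_of_ge hab.le le_rfl, sub_zero]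

theorem hat_apply_of_le {a b c t : ℝ} (hab : a < b) (hbc : b < c) (ht : t ≤ a) :
    hat a b c t = 0 := by
  rw [hat_apply hab.ne hbc.ne, slope_ramp_of_le hbc.ne (ht.trans hab.le)
    (ht.trans (hab.trans hbc).le), slope_ramp_of_le hab.ne ht (ht.trans hab.le), sub_self]

theorem hat_apply_of_ge {a b c t : ℝ} (hab : a < b) (hbc : b < c) (ht : c ≤ t) :
    hat a b c t = 0 := by
  rw [hat_apply hab.ne hbc.ne, slope_ramp_of_ge (hbc.le.trans ht) ht,
    slope_ramp_of_ge ((hab.trans hbc).le.trans ht) (hbc.le.trans ht), sub_self]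

theorem hat_nonneg {a b c : ℝ} (hab : a < b) (hbc : b < c) (t : ℝ) : 0 ≤ hat a b c t := by
  rw [hat_apply hab.ne hbc.ne, sub_nonneg]
  rcases le_total t b with ht | ht
  · rw [slope_ramp_of_le hbc.ne ht (ht.trans hbc.le)]
    exact slope_ramp_le_one t a b
  · rw [slope_ramp_of_ge (hab.le.trans ht) ht]
    exact slope_ramp_nonneg t b c

theorem mem_Ioo_of_hat_ne_zero {a b c t : ℝ} (hab : a < b) (hbc : b < c) (ht : hat a b c t ≠ 0) :
    t ∈ Ioo a c :=
  ⟨not_le.1 fun h => ht (hat_apply_of_le hab hbc h),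
    not_le.1 fun h => ht (hat_apply_of_ge hab hbc h)⟩

/-! ### Minimal interpolants -/

/-- The slopes of the polygon with vertices `(x k, z k)`. -/
noncomputable def secant {n : ℕ} (x : Fin (n + 1) → ℝ) : (Fin (n + 1) → ℝ) →ₗ[ℝ] (Fin n → ℝ) where
  toFun z k := (z k.succ - z k.castSucc) / (x k.succ - x k.castSucc)
  map_add' _ _ := funext fun _ => by simp only [Pi.add_apply]; ring
  map_smul' _ _ := funext fun _ => by simp only [Pi.smul_apply, smul_eq_mul, RingHom.id_apply]; ring

theorem secant_apply {n : ℕ} (x z : Fin (n + 1) → ℝ) (k : Fin n) :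
    secant x z k = (z k.succ - z k.castSucc) / (x k.succ - x k.castSucc) := rfl

theorem secant_comp {n : ℕ} (x : Fin (n + 1) → ℝ) (f : ℝ → ℝ) (k : Fin n) :
    secant x (f ∘ x) k = slope f (x k.castSucc) (x k.succ) :=
  (slope_def_field f _ _).symm

/-- The jumps of the slope, at its interior vertices, of the polygon with vertices
`(x k, z k)`. -/
noncomputable def slopeJump {N : ℕ} (x : Fin (N + 2) → ℝ) :
    (Fin (N + 2) → ℝ) →ₗ[ℝ] (Fin N → ℝ) where
  toFun z k := secant x z k.succ - secant x z k.castSucc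
  map_add' _ _ := funext fun _ => by simp only [map_add, Pi.add_apply]; ring
  map_smul' _ _ := funext fun _ => by simp [mul_sub]

theorem slopeJump_apply {N : ℕ} (x z : Fin (N + 2) → ℝ) (k : Fin N) :
    slopeJump x z k = secant x z k.succ - secant x z k.castSucc := rfl

theorem sum_slopeJump {N : ℕ} (x z : Fin (N + 2) → ℝ) :
    ∑ k, slopeJump x z k = secant x z (Fin.last N) - secant x z 0 := by
  simp only [slopeJump_apply, Finset.sum_sub_distrib]
  linarith [Fin.sum_univ_succ (secant x z), Fin.sum_univ_castSucc (secant x z)]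

theorem slopeVariation_eq_sum_abs_slopeJump {N : ℕ} (x z : Fin (N + 2) → ℝ) :
    slopeVariation x z = ∑ k, |slopeJump x z k| := by
  refine Finset.sum_congr rfl fun k _ => ?_
  rw [slopeJump_apply, secant_apply, secant_apply, abs_sub_comm, ← neg_div_neg_eq, neg_sub, neg_sub]
  rfl

theorem eq_zero_of_slopeJump_eq_zero {N : ℕ} {x u : Fin (N + 2) → ℝ} (hx : StrictMono x)
    (h0 : u 0 = 0) (h1 : u 1 = 0) (hu : slopeJump x u = 0) : u = 0 := by
  have hsecant : ∀ k, secant x u k = 0 := fun k => by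
    induction k using Fin.induction with
    | zero => simp [secant_apply, h0, h1]
    | succ k ih => exact (sub_eq_zero.1 (congrFun hu k)).trans ih
  funext k
  induction k using Fin.induction with
  | zero => exact h0
  | succ k ih =>
    have hk := hsecant k
    rw [secant_apply, div_eq_zero_iff, sub_eq_zero] at hk
    exact (hk.resolve_right (sub_pos.2 (hx k.castSucc_lt_succ)).ne').trans ih

/-- The hat function at the `k`-th interior node, with its two neighbours. -/
noncomputable def nodeHat {N : ℕ} (x : Fin (N + 2) → ℝ) (k : Fin N) : C₀(ℝ, ℝ) :=
  hat (x k.castSucc.castSucc) (x k.succ.castSucc) (x k.succ.succ)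

section nodeHat

variable {N : ℕ} {x : Fin (N + 2) → ℝ} (hx : StrictMono x)
include hx

theorem node_lt_node (k : Fin N) : x k.castSucc.castSucc < x k.succ.castSucc :=
  hx k.castSucc.castSucc_lt_succ

theorem node_lt_node_succ (k : Fin N) : x k.succ.castSucc < x k.succ.succ :=
  hx k.succ.castSucc_lt_succ

theorem weakD2_nodeHat (f : BV2) (k : Fin N) :
    weakD2 f (nodeHat x k) = slopeJump x (f.1 ∘ x) k := by
  rw [nodeHat, weakD2_hat (node_lt_node hx k).ne (node_lt_node_succ hx k).ne, slopeJump_apply,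
    secant_comp, secant_comp]
  rfl

theorem nodeHat_apply (k : Fin N) (t : ℝ) : nodeHat x k t = slopeJump x (ramp t ∘ x) k := by
  rw [nodeHat, hat_apply (node_lt_node hx k).ne (node_lt_node_succ hx k).ne, slopeJump_apply,
    secant_comp, secant_comp]
  rfl

theorem nodeHat_nonneg (k : Fin N) (t : ℝ) : 0 ≤ nodeHat x k t :=
  hat_nonneg (node_lt_node hx k) (node_lt_node_succ hx k) t

theorem nodeHat_apply_node (k j : Fin N) :
    nodeHat x k (x j.succ.castSucc) = if j = k then 1 else 0 := by
  rcases lt_trichotomy j k with h | rfl | h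
  · rw [if_neg h.ne]
    exact hat_apply_of_le (node_lt_node hx k) (node_lt_node_succ hx k)
      (hx.monotone (Fin.castSucc_le_castSucc_iff.2 (Fin.succ_le_castSucc_iff.2 h)))
  · rw [if_pos rfl]
    exact hat_apply_center (node_lt_node hx j) (node_lt_node_succ hx j)
  · rw [if_neg h.ne']
    exact hat_apply_of_ge (node_lt_node hx k) (node_lt_node_succ hx k)
      (hx.monotone (Fin.succ_le_castSucc_iff.2 (Fin.succ_lt_succ_iff.2 h)))

theorem sum_nodeHat_le_one (t : ℝ) : ∑ k, nodeHat x k t ≤ 1 := by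
  simp only [nodeHat_apply hx, sum_slopeJump, secant_comp]
  linarith [slope_ramp_le_one t (x (Fin.last N).castSucc) (x (Fin.last N).succ),
    slope_ramp_nonneg t (x (Fin.castSucc 0)) (x (Fin.succ 0))]

end nodeHat

theorem abs_sum_mul_le_one {ι : Type*} {s : Finset ι} {c a : ι → ℝ} (hc : ∀ i, |c i| ≤ 1)
    (ha : ∀ i, 0 ≤ a i) (hsum : ∑ i ∈ s, a i ≤ 1) : |∑ i ∈ s, c i * a i| ≤ 1 := by
  refine (Finset.abs_sum_le_sum_abs _ _).trans ((Finset.sum_le_sum fun i _ => ?_).trans hsum)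
  rw [abs_mul, abs_of_nonneg (ha i)]
  exact mul_le_of_le_one_left (ha i) (hc i)

theorem exists_sum_smul_apply_eq_sum_abs {ι : Type*} [Fintype ι] {h : ι → C₀(ℝ, ℝ)}
    (h0 : ∀ i t, 0 ≤ h i t) (h1 : ∀ t, ∑ i, h i t ≤ 1) (w : StrongDual ℝ C₀(ℝ, ℝ)) :
    ∃ c : ι → ℝ, (∀ t, |(∑ i, c i • h i) t| ≤ 1) ∧ w (∑ i, c i • h i) = ∑ i, |w (h i)| := by
  refine ⟨fun i => SignType.sign (w (h i)), fun t => ?_, by simp [map_sum, sign_mul_self]⟩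
  rw [c0_sum_smul_apply]
  refine abs_sum_mul_le_one (fun i => ?_) (fun i => h0 i t) (h1 t)
  rcases SignType.sign (w (h i)) with _ | _ | _ <;> simp

theorem sum_abs_apply_le_norm {ι : Type*} [Fintype ι] {h : ι → C₀(ℝ, ℝ)} (h0 : ∀ i t, 0 ≤ h i t)
    (h1 : ∀ t, ∑ i, h i t ≤ 1) (w : StrongDual ℝ C₀(ℝ, ℝ)) : ∑ i, |w (h i)| ≤ ‖w‖ := by
  obtain ⟨c, hc, hwc⟩ := exists_sum_smul_apply_eq_sum_abs h0 h1 w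
  exact hwc.symm.trans_le (dual_apply_le_norm w hc)

/-- Replacing the part `s` of `h` by `g` gives another nonnegative family with sum at most one, and
`h` already attains the norm of `w`. -/
theorem sum_abs_apply_le_of_sum_eq {ι κ : Type*} [Fintype ι] [Fintype κ] {w : StrongDual ℝ C₀(ℝ, ℝ)}
    {h : ι → C₀(ℝ, ℝ)} (hw : ‖w‖ ≤ ∑ i, |w (h i)|) (h0 : ∀ i t, 0 ≤ h i t)
    (h1 : ∀ t, ∑ i, h i t ≤ 1) {g : κ → C₀(ℝ, ℝ)} (g0 : ∀ j t, 0 ≤ g j t) (s : Finset ι)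
    (hg : ∀ t, ∑ j, g j t = ∑ i ∈ s, h i t) : ∑ j, |w (g j)| ≤ ∑ i ∈ s, |w (h i)| := by
  classical
  have hsplit : ∀ a : ι → ℝ, ∑ i, a i = ∑ i ∈ s, a i + ∑ i : {i // i ∈ sᶜ}, a i := fun a => by
    rw [Finset.sum_coe_sort sᶜ a, Finset.sum_add_sum_compl]
  have hle := sum_abs_apply_le_norm (h := Sum.elim g fun i : {i // i ∈ sᶜ} => h i)
    (by simp only [Sum.forall, Sum.elim_inl, Sum.elim_inr]; exact ⟨g0, fun i => h0 i⟩)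
    (fun t => by
      simp only [Fintype.sum_sum_type, Sum.elim_inl, Sum.elim_inr, hg, ← hsplit fun i => h i t]
      exact h1 t) w
  simp only [Fintype.sum_sum_type, Sum.elim_inl, Sum.elim_inr] at hle
  rw [hsplit] at hw
  linarith

theorem slopeVariation_le_norm_weakD2 {N : ℕ} {x : Fin (N + 2) → ℝ} (hx : StrictMono x) (f : BV2) :
    slopeVariation x (f.1 ∘ x) ≤ ‖weakD2 f‖ := by
  rw [slopeVariation_eq_sum_abs_slopeJump]
  simp only [← weakD2_nodeHat hx]
  exact sum_abs_apply_le_norm (nodeHat_nonneg hx) (sum_nodeHat_le_one hx) (weakD2 f)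

theorem norm_sum_smul_dirac_le {ι : Type*} [Fintype ι] (c : ι → ℝ) (t : ι → ℝ) :
    ‖∑ i, c i • dirac (t i)‖ ≤ ∑ i, |c i| := by
  refine norm_dual_le_of_forall (Finset.sum_nonneg fun i _ => abs_nonneg _) fun η hη => ?_
  rw [sum_apply]
  refine Finset.sum_le_sum fun i _ => (le_abs_self _).trans ?_
  rw [smul_apply, dirac_apply, smul_eq_mul, abs_mul]
  exact mul_le_of_le_one_right (abs_nonneg _) (hη _)

theorem exists_interpolant_norm_weakD2_le {N : ℕ} {x : Fin (N + 2) → ℝ} (hx : StrictMono x)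
    (z : Fin (N + 2) → ℝ) : ∃ f : BV2, f.1 ∘ x = z ∧ ‖weakD2 f‖ ≤ slopeVariation x z := by
  set w : StrongDual ℝ C₀(ℝ, ℝ) := ∑ j, slopeJump x z j • dirac (x j.succ.castSucc) with hw
  set f := BV2.ofD2 (hx Fin.zero_lt_one).ne (z 0) (z 1) w with hf
  have hD2 : weakD2 f = w := weakD2_ofD2 _ _ _ _
  refine ⟨f, ?_, ?_⟩
  · rw [← sub_eq_zero]
    refine eq_zero_of_slopeJump_eq_zero hx (by simp [hf, BV2.ofD2_left])
      (by simp [hf, BV2.ofD2_right]) ?_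
    funext k
    rw [map_sub, Pi.sub_apply, ← weakD2_nodeHat hx, hD2, hw]
    simp only [sum_apply, smul_apply, dirac_apply, nodeHat_apply_node hx]
    simp
  · rw [hD2, slopeVariation_eq_sum_abs_slopeJump]
    exact norm_sum_smul_dirac_le _ _

theorem comp_eq_of_mem_tv2Interpolants {M : ℕ} {x z : Fin M → ℝ} {f : BV2}
    (hf : f ∈ tv2Interpolants x z) : f.1 ∘ x = z :=
  funext hf.1

theorem mem_tv2Interpolants_iff {N : ℕ} {x : Fin (N + 2) → ℝ} (hx : StrictMono x)
    {z : Fin (N + 2) → ℝ} {f : BV2} :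
    f ∈ tv2Interpolants x z ↔ f.1 ∘ x = z ∧ ‖weakD2 f‖ ≤ slopeVariation x z := by
  refine ⟨fun hf => ⟨comp_eq_of_mem_tv2Interpolants hf, ?_⟩, fun ⟨hz, hf⟩ => ⟨congrFun hz, ?_⟩⟩
  · obtain ⟨g, hgz, hg⟩ := exists_interpolant_norm_weakD2_le hx z
    exact ((TV2_le_TV2_iff f g).1 (hf.2 g (congrFun hgz))).trans hg
  · rintro g hg
    obtain rfl : g.1 ∘ x = z := funext hg
    exact (TV2_le_TV2_iff f g).2 (hf.trans (slopeVariation_le_norm_weakD2 hx g))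

theorem norm_weakD2_of_mem_tv2Interpolants {N : ℕ} {x z : Fin (N + 2) → ℝ} (hx : StrictMono x)
    {f : BV2} (hf : f ∈ tv2Interpolants x z) : ‖weakD2 f‖ = slopeVariation x z := by
  obtain ⟨rfl, hle⟩ := (mem_tv2Interpolants_iff hx).1 hf
  exact hle.antisymm (slopeVariation_le_norm_weakD2 hx f)

theorem TV2_of_mem_tv2Interpolants {N : ℕ} {x z : Fin (N + 2) → ℝ} (hx : StrictMono x)
    {f : BV2} (hf : f ∈ tv2Interpolants x z) : TV2 f = ENNReal.ofReal (slopeVariation x z) := by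
  rw [TV2_eq_ofReal_norm, norm_weakD2_of_mem_tv2Interpolants hx hf]

theorem tv2Interpolants_nonempty {N : ℕ} {x : Fin (N + 2) → ℝ} (hx : StrictMono x)
    (z : Fin (N + 2) → ℝ) : (tv2Interpolants x z).Nonempty := by
  obtain ⟨f, hf⟩ := exists_interpolant_norm_weakD2_le hx z
  exact ⟨f, (mem_tv2Interpolants_iff hx).2 hf⟩

theorem convex_tv2Interpolants {M : ℕ} (x z : Fin M → ℝ) : Convex ℝ (tv2Interpolants x z) := by
  intro f hf g hg a b ha hb hab
  refine ⟨fun m => ?_, fun h hh => ?_⟩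
  · change a * f.1 (x m) + b * g.1 (x m) = z m
    rw [hf.1, hg.1, ← add_mul, hab, one_mul]
  · have hf' := hf.2 h hh
    have hg' := hg.2 h hh
    rw [TV2_le_TV2_iff] at hf' hg' ⊢
    rw [isLinearMap_weakD2.map_add, isLinearMap_weakD2.map_smul, isLinearMap_weakD2.map_smul]
    refine norm_dual_le_of_forall (norm_nonneg (weakD2 h)) fun η hη => ?_
    calc a * weakD2 f η + b * weakD2 g η ≤ a * ‖weakD2 h‖ + b * ‖weakD2 h‖ :=
          add_le_add
            (mul_le_mul_of_nonneg_left ((dual_apply_le_norm (weakD2 f) hη).trans hf') ha)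
            (mul_le_mul_of_nonneg_left ((dual_apply_le_norm (weakD2 g) hη).trans hg') hb)
      _ = ‖weakD2 h‖ := by rw [← add_mul, hab, one_mul]

theorem norm_weakD2_neg (f : BV2) : ‖weakD2 (-f)‖ = ‖weakD2 f‖ :=
  (congrArg norm (IsLinearMap.map_neg (f := weakD2) isLinearMap_weakD2 f)).trans
    (norm_neg (weakD2 f))

theorem neg_mem_tv2Interpolants {M : ℕ} {x z : Fin M → ℝ} {f : BV2}
    (hf : f ∈ tv2Interpolants x z) : -f ∈ tv2Interpolants x (-z) := by
  refine ⟨fun m => congrArg Neg.neg (hf.1 m), fun g hg => ?_⟩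
  have hle := hf.2 (-g) fun m => neg_eq_iff_eq_neg.2 (hg m)
  rw [TV2_le_TV2_iff] at hle ⊢
  rwa [norm_weakD2_neg] at hle ⊢

theorem mem_tv2Interpolants_of_range_subset {M M' : ℕ} {x z : Fin M → ℝ} {x' : Fin M' → ℝ} {f : BV2}
    (hf : f ∈ tv2Interpolants x z) (hx : Set.range x ⊆ Set.range x') :
    f ∈ tv2Interpolants x' (f.1 ∘ x') :=
  ⟨fun _ => rfl, fun g hg => hf.2 g fun m => by
    obtain ⟨m', hm'⟩ := hx ⟨m, rfl⟩
    rw [← hf.1 m, ← hm']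
    exact hg m'⟩

/-! ### Lipschitz bounds for minimal interpolants -/

theorem sum_abs_lt_sum_abs_of_overshoot {s₀ s₁ s₂ σ₁ σ₂ σ₃ : ℝ} (h₁ : σ₁ < s₁) (h₂ : s₁ < σ₂)
    (h₃ : s₂ < σ₂) :
    |s₁ - s₀| + |s₂ - s₁| < |σ₁ - s₀| + |σ₂ - σ₁| + |σ₃ - σ₂| + |s₂ - σ₃| := by
  have hleft : |s₁ - s₀| ≤ |σ₁ - s₀| + (s₁ - σ₁) := by
    rw [← abs_of_pos (sub_pos.2 h₁), add_comm]
    exact abs_sub_le s₁ σ₁ s₀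
  have hmiddle : σ₂ - σ₁ ≤ |σ₂ - σ₁| := le_abs_self _
  have hright : σ₂ - s₂ ≤ |σ₃ - σ₂| + |s₂ - σ₃| := by
    linarith [neg_abs_le (σ₃ - σ₂), neg_abs_le (s₂ - σ₃)]
  have hold : |s₂ - s₁| < (σ₂ - s₁) + (σ₂ - s₂) := abs_lt.2 ⟨by linarith, by linarith⟩
  linarith

/-- If `L < σ₂`, then one of `σ₁`, `σ₃` is below the mean `s₁`, and the slopes have to move up from
there to `σ₂` and back down to `s₀` or `s₂`, which costs more variation than `hvar` allows. -/
theorem middle_slope_le {L s₀ s₁ s₂ σ₁ σ₂ σ₃ p q r : ℝ} (hs₀ : s₀ ≤ L) (hs₁ : s₁ ≤ L)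
    (hs₂ : s₂ ≤ L) (hp : 0 < p) (hq : 0 < q) (hr : 0 < r)
    (hmean : p * σ₁ + q * σ₂ + r * σ₃ = (p + q + r) * s₁)
    (hvar : |σ₁ - s₀| + |σ₂ - σ₁| + |σ₃ - σ₂| + |s₂ - σ₃| ≤ |s₁ - s₀| + |s₂ - s₁|) :
    σ₂ ≤ L := by
  by_contra! hσ₂
  have hbelow : σ₁ < s₁ ∨ σ₃ < s₁ := by
    by_contra! h
    nlinarith [mul_le_mul_of_nonneg_left h.1 hp.le, mul_le_mul_of_nonneg_left h.2 hr.le,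
      mul_lt_mul_of_pos_left (hs₁.trans_lt hσ₂) hq]
  rcases hbelow with h | h
  · exact hvar.not_gt (sum_abs_lt_sum_abs_of_overshoot h (hs₁.trans_lt hσ₂) (hs₂.trans_lt hσ₂))
  · refine hvar.not_gt ?_
    have := sum_abs_lt_sum_abs_of_overshoot (s₀ := s₂) (σ₃ := σ₁) h (hs₁.trans_lt hσ₂)
      (hs₀.trans_lt hσ₂)
    rw [abs_sub_comm s₁ s₂, abs_sub_comm s₀ s₁, abs_sub_comm σ₃ s₂, abs_sub_comm σ₂ σ₃,
      abs_sub_comm σ₁ σ₂, abs_sub_comm s₀ σ₁] at this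
    linarith

theorem sum_slopes_mul (f : ℝ → ℝ) (b u v c : ℝ) :
    (u - b) * slope f b u + (v - u) * slope f u v + (c - v) * slope f v c
      = ((u - b) + (v - u) + (c - v)) * slope f b c := by
  have h := sub_smul_slope f
  simp only [smul_eq_mul, vsub_eq_sub] at h
  rw [h, h, h, show u - b + (v - u) + (c - v) = c - b by ring, h]
  ring

theorem slope_le_of_mem_tv2Interpolants {N : ℕ} {x z : Fin (N + 3) → ℝ} (hx : StrictMono x)
    {f : BV2} (hf : f ∈ tv2Interpolants x z) {L : ℝ} (hL : ∀ k, secant x z k ≤ L) (i : Fin N)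
    {u v : ℝ} (hu : x i.succ.castSucc.castSucc < u) (huv : u < v)
    (hv : v < x i.succ.succ.castSucc) : slope f.1 u v ≤ L := by
  obtain ⟨rfl, hw⟩ := (mem_tv2Interpolants_iff hx).1 hf
  set a := x i.castSucc.castSucc.castSucc
  set b := x i.succ.castSucc.castSucc
  set c := x i.succ.succ.castSucc
  set d := x i.succ.succ.succ
  have hab : a < b := node_lt_node hx i.castSucc
  have hcd : c < d := node_lt_node_succ hx i.succ
  have hbc : b < c := hu.trans (huv.trans hv)
  have hnode : nodeHat x i.castSucc = hat a b c ∧ nodeHat x i.succ = hat b c d := ⟨rfl, rfl⟩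
  have hexchange : ∑ j, |weakD2 f (![hat a b u, hat b u v, hat u v c, hat v c d] j)|
      ≤ ∑ k ∈ {i.castSucc, i.succ}, |weakD2 f (nodeHat x k)| := by
    refine sum_abs_apply_le_of_sum_eq (hw.trans_eq ?_) (nodeHat_nonneg hx) (sum_nodeHat_le_one hx)
      ?_ {i.castSucc, i.succ} fun t => ?_
    · simp only [slopeVariation_eq_sum_abs_slopeJump, weakD2_nodeHat hx]
    · simp only [Fin.forall_fin_succ, Matrix.cons_val]
      exact ⟨hat_nonneg hab hu, hat_nonneg hu huv, hat_nonneg huv hv, hat_nonneg hv hcd, nofun⟩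
    · rw [Finset.sum_pair i.castSucc_lt_succ.ne, hnode.1, hnode.2, Fin.sum_univ_four]
      simp only [Matrix.cons_val, hat_apply hab.ne hu.ne, hat_apply hu.ne huv.ne,
        hat_apply huv.ne hv.ne, hat_apply hv.ne hcd.ne, hat_apply hab.ne hbc.ne,
        hat_apply hbc.ne hcd.ne]
      ring
  rw [Finset.sum_pair i.castSucc_lt_succ.ne, hnode.1, hnode.2, Fin.sum_univ_four] at hexchange
  simp only [Matrix.cons_val, weakD2_hat hab.ne hu.ne, weakD2_hat hu.ne huv.ne,
    weakD2_hat huv.ne hv.ne, weakD2_hat hv.ne hcd.ne, weakD2_hat hab.ne hbc.ne,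
    weakD2_hat hbc.ne hcd.ne] at hexchange
  simp only [secant_comp] at hL
  exact middle_slope_le (hL i.castSucc.castSucc) (hL i.succ.castSucc) (hL i.succ.succ)
    (sub_pos.2 hu) (sub_pos.2 huv) (sub_pos.2 hv) (sum_slopes_mul f.1 b u v c) hexchange

theorem monotoneOn_Icc_of_Ioo {F : ℝ → ℝ} (hF : Continuous F) {b c : ℝ}
    (h : ∀ u v, b < u → u < v → v < c → F u ≤ F v) : MonotoneOn F (Icc b c) := by
  have hleft : ∀ u v, b ≤ u → u < v → v < c → F u ≤ F v := fun u v hu huv hv =>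
    le_on_closure (s := Ioo b v) (g := fun _ => F v) (fun u hu => h u v hu.1 hu.2 hv)
      hF.continuousOn continuousOn_const (by
        rw [closure_Ioo (hu.trans_lt huv).ne]
        exact ⟨hu, huv.le⟩)
  rintro u ⟨hu, -⟩ v ⟨-, hv⟩ huv
  rcases huv.eq_or_lt with rfl | huv
  · exact le_rfl
  · exact le_on_closure (s := Ioo u c) (f := fun _ => F u) (fun v hv => hleft u v hu hv.1 hv.2)
      continuousOn_const hF.continuousOn (by
        rw [closure_Ioo (huv.trans_le hv).ne]
        exact ⟨huv.le, hv⟩)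

theorem monotoneOn_Icc_of_pieces {n : ℕ} {y : Fin (n + 1) → ℝ} (hy : Monotone y) {F : ℝ → ℝ}
    (h : ∀ i : Fin n, MonotoneOn F (Icc (y i.castSucc) (y i.succ))) :
    MonotoneOn F (Icc (y 0) (y (Fin.last n))) := by
  suffices H : ∀ k, MonotoneOn F (Icc (y 0) (y k)) from H _
  intro k
  induction k using Fin.induction with
  | zero => simp [MonotoneOn]
  | succ i ih =>
    have h₁ : y 0 ≤ y i.castSucc := hy (Fin.zero_le _)
    have h₂ : y i.castSucc ≤ y i.succ := hy i.castSucc_lt_succ.le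
    rw [← Icc_union_Icc_eq_Icc h₁ h₂]
    exact ih.union_right (h i) (isGreatest_Icc h₁) (isLeast_Icc h₂)

theorem monotoneOn_of_mem_tv2Interpolants {N : ℕ} {x z : Fin (N + 3) → ℝ} (hx : StrictMono x)
    {f : BV2} (hf : f ∈ tv2Interpolants x z) {L : ℝ} (hL : ∀ k, secant x z k ≤ L) :
    MonotoneOn (fun t => L * t - f.1 t) (Icc (x 1) (x (Fin.last (N + 1)).castSucc)) := by
  refine monotoneOn_Icc_of_pieces (y := fun k : Fin (N + 1) => x k.succ.castSucc)
    (fun k l hkl => hx.monotone (Fin.castSucc_le_castSucc_iff.2 (Fin.succ_le_succ_iff.2 hkl)))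
    fun i => monotoneOn_Icc_of_Ioo (by have := f.2.1; fun_prop) fun u v hu huv hv => ?_
  have h := slope_le_of_mem_tv2Interpolants hx hf hL i hu huv hv
  rw [slope_def_field, div_le_iff₀ (sub_pos.2 huv)] at h
  linarith

/-- The points `x` with an additional first point `a` and an additional last point `b`. -/
def pad {n : ℕ} (x : Fin n → ℝ) (a b : ℝ) : Fin (n + 2) → ℝ :=
  Fin.cons a (Fin.snoc x b : Fin (n + 1) → ℝ)

section pad

variable {n : ℕ} (x : Fin n → ℝ) (a b : ℝ)

@[simp] theorem pad_last : pad x a b (Fin.last (n + 1)) = b := by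
  rw [← Fin.succ_last, pad, Fin.cons_succ, Fin.snoc_last]

@[simp] theorem pad_castSucc_succ (k : Fin n) : pad x a b k.castSucc.succ = x k := by
  rw [pad, Fin.cons_succ, Fin.snoc_castSucc]

theorem comp_pad (f : ℝ → ℝ) : f ∘ pad x a b = pad (f ∘ x) (f a) (f b) := by
  funext k
  refine Fin.cases rfl (fun k => ?_) k
  refine Fin.lastCases ?_ (fun k => ?_) k <;> simp

theorem range_subset_range_pad : range x ⊆ range (pad x a b) := by
  rintro _ ⟨k, rfl⟩
  exact ⟨k.castSucc.succ, pad_castSucc_succ x a b k⟩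

theorem secant_pad {x z : Fin (n + 1) → ℝ} {a b c d : ℝ} (k : Fin n) :
    secant (pad x a b) (pad z c d) k.castSucc.succ = secant x z k := by
  have h : ∀ (y : Fin (n + 1) → ℝ) (a b : ℝ), pad y a b k.castSucc.succ.succ = y k.succ ∧
      pad y a b k.castSucc.succ.castSucc = y k.castSucc := fun y a b =>
    ⟨pad_castSucc_succ y a b k.succ, pad_castSucc_succ y a b k.castSucc⟩
  rw [secant_apply, secant_apply, (h z c d).1, (h z c d).2, (h x a b).1, (h x a b).2]

end pad

theorem strictMono_pad {n : ℕ} {x : Fin (n + 1) → ℝ} (hx : StrictMono x) {a b : ℝ} (ha : a < x 0)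
    (hb : x (Fin.last n) < b) : StrictMono (pad x a b) := by
  rw [Fin.strictMono_iff_lt_succ]
  intro k
  refine Fin.cases ?_ (fun k => ?_) k
  · exact ha
  · refine Fin.lastCases ?_ (fun k => ?_) k
    · exact ((pad_castSucc_succ x a b _).trans_lt hb).trans_eq (pad_last x a b).symm
    · exact ((pad_castSucc_succ x a b _).trans_lt (hx k.castSucc_lt_succ)).trans_eq
        (pad_castSucc_succ x a b _).symm

theorem slopeVariation_pad {N : ℕ} (x z : Fin (N + 2) → ℝ) (a b c d : ℝ) :
    slopeVariation (pad x a b) (pad z c d) = slopeVariation x z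
      + |secant x z 0 - secant (pad x a b) (pad z c d) 0|
      + |secant (pad x a b) (pad z c d) (Fin.last (N + 2)) - secant x z (Fin.last N)| := by
  simp only [slopeVariation_eq_sum_abs_slopeJump]
  rw [Fin.sum_univ_succ, Fin.sum_univ_castSucc]
  have hfirst : slopeJump (pad x a b) (pad z c d) 0
      = secant x z 0 - secant (pad x a b) (pad z c d) 0 :=
    congrArg (· - _) (secant_pad 0)
  have hmiddle : ∀ k : Fin N,
      slopeJump (pad x a b) (pad z c d) k.castSucc.succ = slopeJump x z k := fun k =>
    congrArg₂ (· - ·) (secant_pad k.succ) (secant_pad k.castSucc)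
  have hlast : slopeJump (pad x a b) (pad z c d) (Fin.last N).succ
      = secant (pad x a b) (pad z c d) (Fin.last (N + 2)) - secant x z (Fin.last N) :=
    congrArg (_ - ·) (secant_pad (Fin.last N))
  rw [hfirst, hlast]
  simp only [hmiddle]
  ring

section pad

variable {N : ℕ} {x z : Fin (N + 2) → ℝ} (hx : StrictMono x) {f : BV2}
  (hf : f ∈ tv2Interpolants x z) {L : ℝ} (hL : ∀ k, secant x z k ≤ L)
include hx hf hL

theorem secant_pad_le_of_mem_tv2Interpolants {a b : ℝ} (ha : a < x 0) (hb : x (Fin.last _) < b)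
    (k : Fin (N + 3)) : secant (pad x a b) (f.1 ∘ pad x a b) k ≤ L := by
  have hpad := mem_tv2Interpolants_of_range_subset hf (range_subset_range_pad x a b)
  have hvar := slopeVariation_pad x z a b (f.1 a) (f.1 b)
  have hcomp : f.1 ∘ pad x a b = pad z (f.1 a) (f.1 b) := by
    rw [comp_pad, comp_eq_of_mem_tv2Interpolants hf]
  rw [← hcomp, ← norm_weakD2_of_mem_tv2Interpolants (strictMono_pad hx ha hb) hpad,
    ← norm_weakD2_of_mem_tv2Interpolants hx hf, add_assoc, left_eq_add,
    add_eq_zero_iff_of_nonneg (abs_nonneg _) (abs_nonneg _), abs_eq_zero, abs_eq_zero, sub_eq_zero,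
    sub_eq_zero] at hvar
  refine Fin.cases (hvar.1.symm.trans_le (hL 0)) (fun k => ?_) k
  refine Fin.lastCases (hvar.2.trans_le (hL _)) (fun k => ?_) k
  rw [hcomp, secant_pad]
  exact hL k

theorem monotone_mul_sub_of_mem_tv2Interpolants : Monotone fun t => L * t - f.1 t := by
  intro u v huv
  set a := min u (x 0) - 1
  set b := max v (x (Fin.last _)) + 1
  have ha : a < x 0 := (sub_one_lt _).trans_le (min_le_right _ _)
  have hb : x (Fin.last _) < b := (le_max_right _ _).trans_lt (lt_add_one _)
  have hau : a ≤ u := (sub_one_lt _).le.trans (min_le_left _ _)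
  have hvb : v ≤ b := (le_max_left _ _).trans (lt_add_one _).le
  have hx' := strictMono_pad hx ha hb
  have hf' := mem_tv2Interpolants_of_range_subset hf (range_subset_range_pad x a b)
  have hL' := secant_pad_le_of_mem_tv2Interpolants hx hf hL ha hb
  have ha' : a - 1 < pad x a b 0 := sub_one_lt a
  have hb' : pad x a b (Fin.last _) < b + 1 := by simp
  have hmono := monotoneOn_of_mem_tv2Interpolants (strictMono_pad hx' ha' hb')
    (mem_tv2Interpolants_of_range_subset hf' (range_subset_range_pad _ (a - 1) (b + 1)))
    (secant_pad_le_of_mem_tv2Interpolants hx' hf' hL' ha' hb')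
  have hends : pad (pad x a b) (a - 1) (b + 1) 1 = a ∧
      pad (pad x a b) (a - 1) (b + 1) (Fin.last (N + 4)).castSucc = b :=
    ⟨pad_castSucc_succ _ _ _ 0, (pad_castSucc_succ _ _ _ (Fin.last _)).trans (pad_last x a b)⟩
  rw [hends.1, hends.2] at hmono
  exact hmono ⟨hau, huv.trans hvb⟩ ⟨hau.trans huv, hvb⟩ huv

end pad

theorem lipConst_le_iff {f : ℝ → ℝ} {L : ℝ} (hL : 0 ≤ L) :
    lipConst f ≤ ENNReal.ofReal L ↔ ∀ u v, |f u - f v| ≤ L * |u - v| := by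
  simp only [lipConst, iSup_le_iff, ENNReal.ofReal_le_ofReal_iff hL]
  refine forall₂_congr fun u v => ⟨fun h => ?_, fun h huv => ?_⟩
  · rcases eq_or_ne u v with rfl | huv
    · simp
    · exact (div_le_iff₀ (abs_pos.2 (sub_ne_zero.2 huv))).1 (h huv)
  · exact (div_le_iff₀ (abs_pos.2 (sub_ne_zero.2 huv))).2 h

theorem lipConst_le_of_monotone {f : ℝ → ℝ} {L : ℝ} (hL : 0 ≤ L)
    (hsub : Monotone fun t => L * t - f t) (hadd : Monotone fun t => L * t + f t) :
    lipConst f ≤ ENNReal.ofReal L := by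
  refine (lipConst_le_iff hL).2 fun u v => ?_
  wlog huv : u ≤ v generalizing u v
  · rw [abs_sub_comm, abs_sub_comm u]
    exact this v u (le_of_not_ge huv)
  · have h₁ : L * u - f u ≤ L * v - f v := hsub huv
    have h₂ : L * u + f u ≤ L * v + f v := hadd huv
    rw [abs_sub_comm u, abs_of_nonneg (sub_nonneg.2 huv), abs_le]
    exact ⟨by linarith, by linarith⟩

theorem norm_secant_le_of_lipConst_le {n : ℕ} {x : Fin (n + 1) → ℝ} (hx : StrictMono x)
    {f : ℝ → ℝ} {L : ℝ} (hL : 0 ≤ L) (hf : lipConst f ≤ ENNReal.ofReal L) :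
    ‖secant x (f ∘ x)‖ ≤ L := by
  refine (pi_norm_le_iff_of_nonneg hL).2 fun k => ?_
  rw [secant_apply, norm_div, div_le_iff₀ (norm_pos_iff.2 (sub_pos.2 (hx k.castSucc_lt_succ)).ne')]
  exact (lipConst_le_iff hL).1 hf _ _

theorem lipConst_le_of_mem_tv2Interpolants {N : ℕ} {x z : Fin (N + 2) → ℝ} (hx : StrictMono x)
    {f : BV2} (hf : f ∈ tv2Interpolants x z) {L : ℝ} (hL : 0 ≤ L) (hz : ‖secant x z‖ ≤ L) :
    lipConst f ≤ ENNReal.ofReal L := by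
  have hsecant : ∀ k, |secant x z k| ≤ L := (pi_norm_le_iff_of_nonneg hL).1 hz
  refine lipConst_le_of_monotone hL
    (monotone_mul_sub_of_mem_tv2Interpolants hx hf fun k => (le_abs_self _).trans (hsecant k)) ?_
  have hneg := monotone_mul_sub_of_mem_tv2Interpolants hx (neg_mem_tv2Interpolants hf) (L := L)
    fun k => by
      rw [map_neg]
      exact (neg_le_abs _).trans (hsecant k)
  have hfun : (fun t => L * t - (-f).1 t) = fun t => L * t + f.1 t :=
    funext fun t => sub_neg_eq_add (L * t) (f.1 t)
  exact hfun ▸ hneg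

/-! ### Weak-* compactness -/

theorem continuous_ofD2_apply {p q : ℝ} (hpq : p ≠ q) (A B t : ℝ) :
    Continuous fun w : WeakDual ℝ C₀(ℝ, ℝ) => (BV2.ofD2 hpq A B (WeakDual.toStrongDual w)).1 t :=
  continuous_const.add (WeakDual.eval_continuous (peanoC0 hpq t))

theorem continuous_ofD2 {p q : ℝ} (hpq : p ≠ q) (A B : ℝ) :
    Continuous[_, BV2.weakStar]
      fun w : WeakDual ℝ C₀(ℝ, ℝ) => BV2.ofD2 hpq A B (WeakDual.toStrongDual w) := by
  refine continuous_induced_rng.2 (.prodMk (continuous_id.congr fun w => ?_)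
    ((continuous_ofD2_apply hpq A B 0).prodMk (continuous_ofD2_apply hpq A B 1)))
  exact (congrArg StrongDual.toWeakDual (weakD2_ofD2 hpq A B _)).symm

theorem tv2Interpolants_eq_image {N : ℕ} {x : Fin (N + 2) → ℝ} (hx : StrictMono x)
    (z : Fin (N + 2) → ℝ) (h01 : x 0 ≠ x 1) :
    tv2Interpolants x z = (fun w => BV2.ofD2 h01 (z 0) (z 1) (WeakDual.toStrongDual w)) ''
      ((WeakDual.toStrongDual ⁻¹'
          Metric.closedBall (0 : StrongDual ℝ C₀(ℝ, ℝ)) (slopeVariation x z)) ∩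
        ⋂ m, {w | (BV2.ofD2 h01 (z 0) (z 1) (WeakDual.toStrongDual w)).1 (x m) = z m}) := by
  have hball : ∀ w : StrongDual ℝ C₀(ℝ, ℝ),
      w ∈ Metric.closedBall 0 (slopeVariation x z) ↔ ‖w‖ ≤ slopeVariation x z := fun w => by
    rw [Metric.mem_closedBall, show dist w 0 = ‖w‖ from dist_zero_right w]
  ext f
  rw [mem_tv2Interpolants_iff hx]
  constructor
  · rintro ⟨hz, hnorm⟩
    have hf : BV2.ofD2 h01 (z 0) (z 1) (weakD2 f) = f := by
      subst hz
      exact (BV2.eq_ofD2 h01 f).symm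
    refine ⟨StrongDual.toWeakDual (weakD2 f), ⟨(hball (weakD2 f)).2 hnorm,
      mem_iInter.2 fun m => ?_⟩, hf⟩
    exact (congrArg (fun g : BV2 => g.1 (x m)) hf).trans (congrFun hz m)
  · rintro ⟨w, ⟨hnorm, hz⟩, rfl⟩
    rw [weakD2_ofD2]
    exact ⟨funext fun m => mem_iInter.1 hz m, (hball _).1 hnorm⟩

theorem isWeakStarCompact_tv2Interpolants {N : ℕ} {x : Fin (N + 2) → ℝ} (hx : StrictMono x)
    (z : Fin (N + 2) → ℝ) : IsWeakStarCompact (tv2Interpolants x z) := by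
  have h01 : x 0 ≠ x 1 := (hx Fin.zero_lt_one).ne
  rw [IsWeakStarCompact, tv2Interpolants_eq_image hx z h01]
  refine @IsCompact.image _ _ _ BV2.weakStar _ _ ?_ (continuous_ofD2 h01 (z 0) (z 1))
  exact (WeakDual.isCompact_closedBall 0 _).inter_right
    (isClosed_iInter fun m => isClosed_eq (continuous_ofD2_apply h01 _ _ (x m)) continuous_const)

/-! ### Extreme points -/

theorem eq_zero_of_mem_extremePoints {V : Type*} [AddCommGroup V] [Module ℝ V] {K : Set V}
    {f g : V} (hf : f ∈ K.extremePoints ℝ) (hadd : f + g ∈ K) (hsub : f - g ∈ K) : g = 0 := by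
  have hmid : f ∈ openSegment ℝ (f + g) (f - g) :=
    ⟨2⁻¹, 2⁻¹, by norm_num, by norm_num, by norm_num, by module⟩
  exact left_eq_add.1 (hf.2 hadd hsub hmid).symm

/-- The measure `ρ w` with density `ρ` with respect to `w`, as a function of `ρ`. -/
noncomputable def mulDual (w : StrongDual ℝ C₀(ℝ, ℝ)) : C₀(ℝ, ℝ) →ₗ[ℝ] StrongDual ℝ C₀(ℝ, ℝ) :=
  (ContinuousLinearMap.compL ℝ C₀(ℝ, ℝ) C₀(ℝ, ℝ) ℝ w).toLinearMap ∘ₗ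
    (ContinuousLinearMap.mul ℝ C₀(ℝ, ℝ)).toLinearMap

theorem mulDual_apply (w : StrongDual ℝ C₀(ℝ, ℝ)) (ρ η : C₀(ℝ, ℝ)) :
    mulDual w ρ η = w (ρ * η) := rfl

theorem norm_add_mulDual_le {w : StrongDual ℝ C₀(ℝ, ℝ)} {η ρ : C₀(ℝ, ℝ)} (hη : ∀ t, |η t| ≤ 1)
    (hw : ‖w‖ ≤ w η) (hρ : ∀ t, |ρ t| ≤ 1) (h0 : mulDual w ρ η = 0) :
    ‖w + mulDual w ρ‖ ≤ ‖w‖ := by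
  refine norm_dual_le_of_forall (norm_nonneg w) fun φ hφ => ?_
  -- The competitor is the pointwise convex combination of `η` and `φ` with weights `(1 ∓ ρ) / 2`.
  have hle := dual_apply_le_norm w (η := (2⁻¹ : ℝ) • (η - ρ * η + φ + ρ * φ)) fun t => by
    have hcomb : ((2⁻¹ : ℝ) • (η - ρ * η + φ + ρ * φ)) t
        = (1 - ρ t) / 2 * η t + (1 + ρ t) / 2 * φ t := by
      simp only [ZeroAtInftyContinuousMap.smul_apply, ZeroAtInftyContinuousMap.add_apply,
        ZeroAtInftyContinuousMap.sub_apply, ZeroAtInftyContinuousMap.mul_apply, smul_eq_mul]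
      ring
    obtain ⟨hρ₁, hρ₂⟩ := abs_le.1 (hρ t)
    have hball := convex_closedBall (0 : ℝ) 1 (mem_closedBall_zero_iff.2 (hη t))
      (mem_closedBall_zero_iff.2 (hφ t)) (by linarith : 0 ≤ (1 - ρ t) / 2)
      (by linarith : 0 ≤ (1 + ρ t) / 2) (by ring)
    rw [hcomb]
    exact mem_closedBall_zero_iff.1 hball
  rw [map_smul, map_add, map_add, map_sub, ← mulDual_apply, h0, smul_eq_mul] at hle
  rw [add_apply, mulDual_apply]
  linarith

section mulDual

variable {N : ℕ} {x z : Fin (N + 2) → ℝ} (hx : StrictMono x) {f : BV2} {ρ : C₀(ℝ, ℝ)}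
include hx

theorem add_mem_tv2Interpolants_of_weakD2_eq_mulDual (hf : f ∈ tv2Interpolants x z)
    (hρ : ∀ t, |ρ t| ≤ 1) (hρx : ∀ k, mulDual (weakD2 f) ρ (nodeHat x k) = 0) {g : BV2}
    (hg : weakD2 g = mulDual (weakD2 f) ρ) (h0 : g.1 (x 0) = 0) (h1 : g.1 (x 1) = 0) :
    f + g ∈ tv2Interpolants x z := by
  have hgx : g.1 ∘ x = 0 := eq_zero_of_slopeJump_eq_zero hx h0 h1 (funext fun k => by
    rw [← weakD2_nodeHat hx, hg, hρx, Pi.zero_apply])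
  obtain ⟨hfx, hw⟩ := (mem_tv2Interpolants_iff hx).1 hf
  obtain ⟨c, hc, hwc⟩ := exists_sum_smul_apply_eq_sum_abs (nodeHat_nonneg hx)
    (sum_nodeHat_le_one hx) (weakD2 f)
  simp only [weakD2_nodeHat hx, hfx, ← slopeVariation_eq_sum_abs_slopeJump] at hwc
  refine (mem_tv2Interpolants_iff hx).2 ⟨?_, ?_⟩
  · change f.1 ∘ x + g.1 ∘ x = z
    rw [hgx, add_zero, hfx]
  · rw [isLinearMap_weakD2.map_add, hg]
    refine (norm_add_mulDual_le hc (hw.trans_eq hwc.symm) hρ ?_).trans hw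
    simp only [map_sum, map_smul, hρx, smul_zero, Finset.sum_const_zero]

theorem mulDual_eq_zero_of_mem_extremePoints (hf : f ∈ (tv2Interpolants x z).extremePoints ℝ)
    (hρx : ∀ k, mulDual (weakD2 f) ρ (nodeHat x k) = 0) : mulDual (weakD2 f) ρ = 0 := by
  wlog hρ : ∀ t, |ρ t| ≤ 1 generalizing ρ
  · have hpos : 0 < ‖ρ‖ + 1 := by positivity
    have hscaled := this (ρ := (‖ρ‖ + 1)⁻¹ • ρ) (fun k => by
      rw [map_smul, smul_apply, hρx, smul_zero]) fun t => by
        rw [ZeroAtInftyContinuousMap.smul_apply, smul_eq_mul, abs_mul, abs_inv, abs_of_pos hpos,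
          inv_mul_le_one₀ hpos]
        linarith [abs_c0_apply_le ρ t]
    rw [map_smul] at hscaled
    exact (smul_eq_zero.1 hscaled).resolve_left (inv_ne_zero hpos.ne')
  have h01 : x 0 ≠ x 1 := (hx Fin.zero_lt_one).ne
  set g := BV2.ofD2 h01 0 0 (mulDual (weakD2 f) ρ)
  have hg : weakD2 g = mulDual (weakD2 f) ρ := weakD2_ofD2 _ _ _ _
  have hg0 : g.1 (x 0) = 0 := BV2.ofD2_left _ _ _ _
  have hg1 : g.1 (x 1) = 0 := BV2.ofD2_right _ _ _ _
  have hg_zero : g = 0 := eq_zero_of_mem_extremePoints hf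
    (add_mem_tv2Interpolants_of_weakD2_eq_mulDual hx hf.1 hρ hρx hg hg0 hg1) (by
      rw [sub_eq_add_neg]
      refine add_mem_tv2Interpolants_of_weakD2_eq_mulDual hx hf.1 (ρ := -ρ)
        (fun t => (abs_neg (ρ t)).trans_le (hρ t)) (fun k => ?_) ?_ (neg_eq_zero.2 hg0)
        (neg_eq_zero.2 hg1)
      · rw [map_neg, neg_apply, hρx, neg_zero]
      · rw [map_neg, ← hg]
        exact IsLinearMap.map_neg (f := weakD2) isLinearMap_weakD2 g)
  rw [← hg, hg_zero]
  exact IsLinearMap.map_zero (f := weakD2) isLinearMap_weakD2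

end mulDual

/-! ### Knots -/

/-- The points near which `f` is not affine. -/
def knots (f : ℝ → ℝ) : Set ℝ :=
  {t | ¬∃ a b : ℝ, ∀ᶠ x in 𝓝 t, f x = a * x + b}

theorem eq_affine_of_slope_eq {f : ℝ → ℝ} {p q x : ℝ} (hpx : p < x) (hxq : x < q)
    (h : slope f x q = slope f p x) : f x = slope f p q * x + (f p - slope f p q * p) := by
  have hxp : x - p ≠ 0 := (sub_pos.2 hpx).ne'
  have hqx : q - x ≠ 0 := (sub_pos.2 hxq).ne'
  have hqp : q - p ≠ 0 := (sub_pos.2 (hpx.trans hxq)).ne'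
  rw [slope_def_field, slope_def_field, div_eq_div_iff hqx hxp] at h
  rw [slope_def_field]
  field_simp
  linarith

theorem exists_slope_ne_of_mem_knots {f : ℝ → ℝ} {t : ℝ} (ht : t ∈ knots f) {U : Set ℝ}
    (hU : U ∈ 𝓝 t) : ∃ a b c, a < b ∧ b < c ∧ Icc a c ⊆ U ∧ slope f b c ≠ slope f a b := by
  obtain ⟨p, q, -, hpq, hsub⟩ := exists_Icc_mem_subset_of_mem_nhds hU
  by_contra! h
  refine ht ⟨slope f p q, f p - slope f p q * p, ?_⟩
  filter_upwards [isOpen_Ioo.mem_nhds (Icc_mem_nhds_iff.1 hpq)] with y hy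
  exact eq_affine_of_slope_eq hy.1 hy.2 (h p y q hy.1 hy.2 hsub)

/-- The square root of a function in `C₀(ℝ)`, equal to `0` where the function is negative. -/
noncomputable def c0Sqrt (g : C₀(ℝ, ℝ)) : C₀(ℝ, ℝ) where
  toFun t := √(g t)
  continuous_toFun := g.continuous.sqrt
  zero_at_infty' := by
    have h := (Real.continuous_sqrt.tendsto 0).comp g.zero_at_infty'
    rwa [Real.sqrt_zero] at h

theorem c0Sqrt_apply (g : C₀(ℝ, ℝ)) (t : ℝ) : c0Sqrt g t = √(g t) := rfl

theorem c0Sqrt_mul_self {g : C₀(ℝ, ℝ)} (hg : ∀ t, 0 ≤ g t) : c0Sqrt g * c0Sqrt g = g := by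
  ext t
  exact Real.mul_self_sqrt (hg t)

theorem exists_mulDual_self_ne_zero_of_mem_knots {f : BV2} {s : ℝ} (hs : s ∈ knots f.1) {U : Set ℝ}
    (hU : U ∈ 𝓝 s) : ∃ ρ : C₀(ℝ, ℝ), mulDual (weakD2 f) ρ ρ ≠ 0 ∧ ∀ t ∉ U, ρ t = 0 := by
  obtain ⟨a, b, c, hab, hbc, hsub, hne⟩ := exists_slope_ne_of_mem_knots hs hU
  refine ⟨c0Sqrt (hat a b c), ?_, fun t ht => ?_⟩
  · rwa [mulDual_apply, c0Sqrt_mul_self (hat_nonneg hab hbc), weakD2_hat hab.ne hbc.ne, sub_ne_zero]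
  · rw [c0Sqrt_apply, Real.sqrt_eq_zero']
    exact (not_ne_iff.1 fun h =>
      ht (hsub (Ioo_subset_Icc_self (mem_Ioo_of_hat_ne_zero hab hbc h)))).le

theorem exists_mulDual_orthogonal_of_subset_knots {f : BV2} {S : Finset ℝ}
    (hS : (S : Set ℝ) ⊆ knots f.1) :
    ∃ ρ : S → C₀(ℝ, ℝ), (∀ s, mulDual (weakD2 f) (ρ s) (ρ s) ≠ 0) ∧
      ∀ s t, s ≠ t → mulDual (weakD2 f) (ρ s) (ρ t) = 0 := by
  obtain ⟨U, hU, hdisj⟩ := S.finite_toSet.t2_separation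
  choose ρ hρ hρU using fun s : S =>
    exists_mulDual_self_ne_zero_of_mem_knots (hS s.2) ((hU s).2.mem_nhds (hU s).1)
  refine ⟨ρ, hρ, fun s t hst => ?_⟩
  have hmul : ρ s * ρ t = 0 := by
    ext y
    by_cases hy : y ∈ U s
    · have hy' : y ∉ U t := disjoint_left.1 (hdisj s.2 t.2 fun h => hst (Subtype.ext h)) hy
      simp [hρU t y hy']
    · simp [hρU s y hy]
  rw [mulDual_apply, hmul, map_zero]

theorem card_le_of_subset_knots {f : BV2} {N : ℕ} {h : Fin N → C₀(ℝ, ℝ)}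
    (hf : ∀ ρ, (∀ k, mulDual (weakD2 f) ρ (h k) = 0) → mulDual (weakD2 f) ρ = 0)
    {S : Finset ℝ} (hS : (S : Set ℝ) ⊆ knots f.1) : S.card ≤ N := by
  obtain ⟨ρ, hρ, horth⟩ := exists_mulDual_orthogonal_of_subset_knots hS
  have hindep : LinearIndependent ℝ fun s => fun k => mulDual (weakD2 f) (ρ s) (h k) := by
    refine Fintype.linearIndependent_iff.2 fun α hα s => ?_
    have hzero := hf (∑ s, α s • ρ s) fun k => by
      simpa [map_sum, sum_apply] using congrFun hα k
    have hs := congrArg (fun w => w (ρ s)) hzero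
    simp only [map_sum, map_smul, sum_apply, smul_apply, zero_apply] at hs
    rw [Finset.sum_eq_single s (fun t _ hts => by rw [horth t s hts, smul_zero]) (by simp),
      smul_eq_mul, mul_eq_zero] at hs
    exact hs.resolve_right (hρ s)
  simpa using hindep.fintype_card_le_finrank

theorem affine_coeff_unique {f : ℝ → ℝ} {t a b a' b' : ℝ} (h : ∀ᶠ x in 𝓝 t, f x = a * x + b)
    (h' : ∀ᶠ x in 𝓝 t, f x = a' * x + b') : a = a' ∧ b = b' := by
  have heq : (fun x => a * x + b) =ᶠ[𝓝 t] fun x => a' * x + b' := by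
    filter_upwards [h, h'] with x hx hx'
    rw [← hx, ← hx']
  have hderiv : a = a' := by simpa using heq.deriv_eq
  subst hderiv
  exact ⟨rfl, add_left_cancel heq.self_of_nhds⟩

theorem exists_eq_affine_of_disjoint_knots {f : ℝ → ℝ} {I : Set ℝ} (hI : I.OrdConnected)
    (hd : Disjoint I (knots f)) : ∃ a b : ℝ, ∀ t ∈ I, f t = a * t + b := by
  rcases I.eq_empty_or_nonempty with rfl | ⟨s, hs⟩
  · exact ⟨0, 0, by simp⟩
  have hlocal : ∀ t ∈ I, ∃ a b : ℝ, ∀ᶠ x in 𝓝 t, f x = a * x + b := fun t ht =>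
    not_not.1 (disjoint_left.1 hd ht)
  have hglue : ∀ t ∈ I, ∃ a b : ℝ, (∀ᶠ x in 𝓝 s, f x = a * x + b) ∧
      ∀ᶠ x in 𝓝 t, f x = a * x + b := fun t ht => by
    refine hI.isPreconnected.induction₂ (fun s t => ∃ a b : ℝ, (∀ᶠ x in 𝓝 s, f x = a * x + b) ∧
      ∀ᶠ x in 𝓝 t, f x = a * x + b) (fun u hu => ?_) ?_ ?_ hs ht
    · obtain ⟨a, b, h⟩ := hlocal u hu
      filter_upwards [mem_nhdsWithin_of_mem_nhds h.eventually_nhds] with v hv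
      exact ⟨a, b, h, hv⟩
    · rintro u v w - - - ⟨a, b, hu, hv⟩ ⟨a', b', hv', hw⟩
      obtain ⟨rfl, rfl⟩ := affine_coeff_unique hv hv'
      exact ⟨a, b, hu, hw⟩
    · rintro u v - - ⟨a, b, hu, hv⟩
      exact ⟨a, b, hv, hu⟩
  obtain ⟨a, b, h⟩ := hlocal s hs
  refine ⟨a, b, fun t ht => ?_⟩
  obtain ⟨a', b', hs', ht'⟩ := hglue t ht
  obtain ⟨rfl, rfl⟩ := affine_coeff_unique h hs'
  exact ht'.self_of_nhds

theorem isLinearSpline_of_card_knots_le {f : ℝ → ℝ} (hf : Continuous f) {N : ℕ}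
    (h : ∀ S : Finset ℝ, (S : Set ℝ) ⊆ knots f → S.card ≤ N) : IsLinearSpline f (N + 1) := by
  have hfin : (knots f).Finite := by
    by_contra hinf
    obtain ⟨S, hS, hcard⟩ := Set.Infinite.exists_subset_card_eq hinf (N + 1)
    exact (h S hS).not_gt (by omega)
  exact ⟨hf, hfin.toFinset, Nat.succ_le_succ (h _ hfin.coe_toFinset.subset), fun I hI hd =>
    exists_eq_affine_of_disjoint_knots hI (by rwa [hfin.coe_toFinset] at hd)⟩

theorem isLinearSpline_of_mem_extremePoints {N : ℕ} {x z : Fin (N + 2) → ℝ} (hx : StrictMono x)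
    {f : BV2} (hf : f ∈ (tv2Interpolants x z).extremePoints ℝ) : IsLinearSpline f.1 (N + 1) :=
  isLinearSpline_of_card_knots_le f.2.1 fun _ hS =>
    card_le_of_subset_knots (fun _ => mulDual_eq_zero_of_mem_extremePoints hx hf) hS

/-! ### The finite-dimensional problem -/

theorem tendsto_sum_apply_cocompact_atTop {ι : Type*} [Fintype ι] {X : ι → Type*}
    [∀ i, TopologicalSpace (X i)] {φ : ∀ i, X i → ℝ}
    (hφ : ∀ i, Tendsto (φ i) (cocompact (X i)) atTop) (hbdd : ∀ i, BddBelow (range (φ i))) :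
    Tendsto (fun z => ∑ i, φ i (z i)) (cocompact (∀ i, X i)) atTop := by
  classical
  choose b hb using hbdd
  have hb' : ∀ i u, b i ≤ φ i u := fun i u => hb i (mem_range_self u)
  rw [← Filter.coprodᵢ_cocompact, Filter.coprodᵢ, tendsto_iSup]
  refine fun i => tendsto_atTop_mono (fun z => ?_)
    (tendsto_atTop_add_const_right _ (∑ j ∈ Finset.univ.erase i, b j)
      ((hφ i).comp tendsto_comap))
  rw [← Finset.add_sum_erase _ _ (Finset.mem_univ i)]
  exact add_le_add_right (Finset.sum_le_sum fun j _ => hb' j (z j)) _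

theorem strictConvexOn_sum_apply {ι : Type*} [Fintype ι] {φ : ι → ℝ → ℝ}
    (hφ : ∀ i, StrictConvexOn ℝ univ (φ i)) :
    StrictConvexOn ℝ univ fun z : ι → ℝ => ∑ i, φ i (z i) := by
  refine ⟨convex_univ, fun z _ z' _ hne a b ha hb hab => ?_⟩
  obtain ⟨i, hi⟩ := Function.ne_iff.1 hne
  simp only [smul_eq_mul, Finset.mul_sum, ← Finset.sum_add_distrib]
  exact Finset.sum_lt_sum
    (fun j _ => (hφ j).convexOn.2 (mem_univ _) (mem_univ _) ha.le hb.le hab)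
    ⟨i, Finset.mem_univ i, (hφ i).2 (mem_univ _) (mem_univ _) hi ha hb hab⟩

theorem exists_minimizer_unique_of_strictConvexOn {ι : Type*} [Fintype ι] {φ : ι → ℝ → ℝ}
    (hconvex : ∀ i, StrictConvexOn ℝ univ (φ i))
    (hcoercive : ∀ i, Tendsto (φ i) (cocompact ℝ) atTop) {R : (ι → ℝ) → ℝ}
    (hR : ConvexOn ℝ univ R) (hR0 : ∀ z, 0 ≤ R z) {C : Set (ι → ℝ)} (hCc : IsClosed C)
    (hC : Convex ℝ C) (hCne : C.Nonempty) :
    ∃ z ∈ C, (∀ z' ∈ C, ∑ i, φ i (z i) + R z ≤ ∑ i, φ i (z' i) + R z') ∧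
      ∀ z' ∈ C, ∑ i, φ i (z' i) + R z' ≤ ∑ i, φ i (z i) + R z → z' = z := by
  let F : (ι → ℝ) → ℝ := fun z => ∑ i, φ i (z i) + R z
  have hF : StrictConvexOn ℝ univ F := (strictConvexOn_sum_apply hconvex).add_convexOn hR
  have hFcont : Continuous F := continuousOn_univ.1 (hF.convexOn.continuousOn isOpen_univ)
  have hbdd : ∀ i, BddBelow (range (φ i)) := fun i => by
    have hcont : Continuous (φ i) :=
      continuousOn_univ.1 ((hconvex i).convexOn.continuousOn isOpen_univ)
    obtain ⟨u, hu⟩ := hcont.exists_forall_le (hcoercive i)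
    exact ⟨φ i u, forall_mem_range.2 hu⟩
  have hFtop : Tendsto F (cocompact _) atTop :=
    tendsto_atTop_mono (fun z => le_add_of_nonneg_right (hR0 z))
      (tendsto_sum_apply_cocompact_atTop hcoercive hbdd)
  obtain ⟨z₀, hz₀⟩ := hCne
  obtain ⟨z, hz, hmin⟩ := hFcont.continuousOn.exists_isMinOn' hCc hz₀
    ((hFtop.eventually_ge_atTop (F z₀)).filter_mono inf_le_left)
  exact ⟨z, hz, hmin, fun z' hz' hle => (hF.subset (subset_univ C) hC).eq_of_isMinOn
    (fun w hw => hle.trans (hmin hw)) hmin hz' hz⟩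

theorem slopeVariation_nonneg {M : ℕ} (x z : Fin M → ℝ) : 0 ≤ slopeVariation x z :=
  Finset.sum_nonneg fun _ _ => abs_nonneg _

theorem convexOn_slopeVariation {N : ℕ} (x : Fin (N + 2) → ℝ) :
    ConvexOn ℝ univ (slopeVariation x) := by
  have habs : ∀ k, ConvexOn ℝ univ fun z => |slopeJump x z k| := fun k =>
    (convexOn_norm (E := ℝ) convex_univ).comp_linearMap
      ((LinearMap.proj k : (Fin N → ℝ) →ₗ[ℝ] ℝ) ∘ₗ slopeJump x)
  have hsum : slopeVariation x = ∑ k, fun z => |slopeJump x z k| :=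
    funext fun z => by rw [slopeVariation_eq_sum_abs_slopeJump, Finset.sum_apply]
  rw [hsum]
  exact Finset.sum_induction _ (ConvexOn ℝ univ) (fun _ _ => ConvexOn.add)
    (convexOn_const 0 convex_univ) fun k _ => habs k

theorem convex_setOf_norm_secant_le {n : ℕ} (x : Fin (n + 1) → ℝ) (L : ℝ) :
    Convex ℝ {z | ‖secant x z‖ ≤ L} := by
  have hcomp := (convexOn_norm (convex_univ (E := Fin n → ℝ) (𝕜 := ℝ))).comp_linearMap (secant x)
  simpa using hcomp.convex_le L

theorem isClosed_setOf_norm_secant_le {n : ℕ} (x : Fin (n + 1) → ℝ) (L : ℝ) :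
    IsClosed {z | ‖secant x z‖ ≤ L} :=
  isClosed_le (secant x).continuous_of_finiteDimensional.norm continuous_const

/-! ### The Lipschitz-constrained problem -/

theorem le_hybridCost {N : ℕ} {x : Fin (N + 2) → ℝ} (hx : StrictMono x) (E : ℝ → ℝ → ℝ)
    (y : Fin (N + 2) → ℝ) {lam : ℝ} (hlam : 0 ≤ lam) (f : BV2) :
    ∑ m, E (f.1 (x m)) (y m) + lam * slopeVariation x (f.1 ∘ x) ≤ hybridCost E x y lam f := by
  rw [hybridCost, toReal_TV2]
  gcongr
  exact slopeVariation_le_norm_weakD2 hx f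

theorem hybridCost_of_mem_tv2Interpolants {N : ℕ} {x z : Fin (N + 2) → ℝ} (hx : StrictMono x)
    (E : ℝ → ℝ → ℝ) (y : Fin (N + 2) → ℝ) (lam : ℝ) {f : BV2} (hf : f ∈ tv2Interpolants x z) :
    hybridCost E x y lam f = ∑ m, E (z m) (y m) + lam * slopeVariation x z := by
  simp only [hybridCost, toReal_TV2, norm_weakD2_of_mem_tv2Interpolants hx hf, hf.1]

theorem exists_hybridSolutions_eq_tv2Interpolants {N : ℕ} {x : Fin (N + 2) → ℝ} (hx : StrictMono x)
    {E : ℝ → ℝ → ℝ} {y : Fin (N + 2) → ℝ}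
    (hconvex : ∀ m, StrictConvexOn ℝ Set.univ fun u => E u (y m))
    (hcoercive : ∀ m, Filter.Tendsto (fun u => E u (y m)) (Filter.cocompact ℝ) Filter.atTop)
    {lam L : ℝ} (hlam : 0 < lam) (hL : 0 ≤ L) :
    ∃ z : Fin (N + 2) → ℝ, hybridSolutions E x y lam L = tv2Interpolants x z := by
  obtain ⟨z, hz, hmin, huniq⟩ := exists_minimizer_unique_of_strictConvexOn hconvex hcoercive
    ((convexOn_slopeVariation x).smul hlam.le)
    (fun z => mul_nonneg hlam.le (slopeVariation_nonneg x z)) (isClosed_setOf_norm_secant_le x L)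
    (convex_setOf_norm_secant_le x L) ⟨0, by simpa using hL⟩
  refine ⟨z, Set.Subset.antisymm (fun f hf => ?_) fun f hf => ?_⟩
  · obtain ⟨g, hg⟩ := tv2Interpolants_nonempty hx z
    have hcost : hybridCost E x y lam f ≤ ∑ m, E (z m) (y m) + lam * slopeVariation x z :=
      (hf.2 g (lipConst_le_of_mem_tv2Interpolants hx hg hL hz)).trans_eq
        (hybridCost_of_mem_tv2Interpolants hx E y lam hg)
    have hfz : f.1 ∘ x = z := huniq _ (norm_secant_le_of_lipConst_le hx hL hf.1)
      ((le_hybridCost hx E y hlam.le f).trans hcost)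
    refine (mem_tv2Interpolants_iff hx).2 ⟨hfz, ?_⟩
    subst hfz
    rw [hybridCost, toReal_TV2] at hcost
    exact le_of_mul_le_mul_left (le_of_add_le_add_left hcost) hlam
  · refine ⟨lipConst_le_of_mem_tv2Interpolants hx hf hL hz, fun g hg => ?_⟩
    rw [hybridCost_of_mem_tv2Interpolants hx E y lam hf]
    exact (hmin _ (norm_secant_le_of_lipConst_le hx hL hg)).trans
      (le_hybridCost hx E y hlam.le g)

end

theorem theorem3 {M : ℕ} (hM : 2 ≤ M) (x y : Fin M → ℝ) (hx : StrictMono x)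
    (E : ℝ → ℝ → ℝ)
    (hE_convex : ∀ v, StrictConvexOn ℝ Set.univ (fun u => E u v))
    (hE_coercive : ∀ v, Filter.Tendsto (fun u => E u v) (Filter.cocompact ℝ) Filter.atTop)
    (lam Lbar : ℝ) (hlam : 0 < lam) (hLbar : 0 < Lbar) :
    (hybridSolutions E x y lam Lbar).Nonempty ∧
    Convex ℝ (hybridSolutions E x y lam Lbar) ∧
    IsWeakStarCompact (hybridSolutions E x y lam Lbar) ∧
    (∀ f ∈ (hybridSolutions E x y lam Lbar).extremePoints ℝ, IsLinearSpline f (M - 1)) ∧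
    ∃ z : Fin M → ℝ,
      hybridSolutions E x y lam Lbar = tv2Interpolants x z ∧
      (∀ z' : Fin M → ℝ, hybridSolutions E x y lam Lbar = tv2Interpolants x z' → z' = z) ∧
      ∀ f ∈ hybridSolutions E x y lam Lbar, TV2 f = ENNReal.ofReal (slopeVariation x z) := by
  obtain ⟨N, rfl⟩ : ∃ N, M = N + 2 := ⟨M - 2, by omega⟩
  obtain ⟨z, hz⟩ := exists_hybridSolutions_eq_tv2Interpolants hx (fun m => hE_convex (y m))
    (fun m => hE_coercive (y m)) hlam hLbar.le
  rw [hz]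
  refine ⟨tv2Interpolants_nonempty hx z, convex_tv2Interpolants x z,
    isWeakStarCompact_tv2Interpolants hx z, fun f hf => isLinearSpline_of_mem_extremePoints hx hf,
    z, rfl, fun z' hz' => ?_, fun f hf => TV2_of_mem_tv2Interpolants hx hf⟩
  obtain ⟨f, hf⟩ := tv2Interpolants_nonempty hx z
  have hf' : f ∈ tv2Interpolants x z' := hz' ▸ hf
  exact funext fun m => (hf'.1 m).symm.trans (hf.1 m)
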